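/- Let $\theta\in\mathbb R$ be irrational and $\lambda=e^{2\pi i\theta}$. Let $\mathcal O(\mathbb T^2_\theta)$ be the complex $*$-algebra generated by unitaries $V,W$ subject to $VW=\lambda WV$, let $\sigma$ be its algebra automorphism with $\sigma(V)=V^*$, $\sigma(W)=W^*$, and put $\mathcal O(\mathbb T^2_\theta)_\pm=\{a:\sigma(a)=\pm a\}$. The noncommutative pillow algebra is $\mathcal O(\mathbb P_\theta)=\mathcal O(\mathbb T^2_\theta)_+$. Let $\partial_V,\partial_W$ be the derivations of $\mathcal O(\mathbb T^2_\theta)$ with $\partial_V(V^mW^n)=im\,V^mW^n$ and $\partial_W(V^mW^n)=in\,V^mW^n$ for $m,n\in\mathbb Z$. Let $\Omega(\mathbb P_\theta)$ be the differential graded algebra with $$\Omega^0=\mathcal O(\mathbb P_\theta),\quad \Omega^1=\mathcal O(\mathbb T^2_\theta)_-\oplus\mathcal O(\mathbb T^2_\theta)_-,\quad \Omega^2=\mathcal O(\mathbb P_\theta),\quad \Omega^n=0\ (n>2),$$ whose product is $(a_1,a_2)\wedge(a_3,a_4)=a_1a_4-a_2a_3$ on $\Omega^1$ and the (componentwise)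 multiplication of $\mathcal O(\mathbb T^2_\theta)$ whenever one factor lies in $\Omega^0$, and whose differential is $da=(\partial_V a,\partial_W a)$ on $\Omega^0$ and $d(a_1,a_2)=\partial_V a_2-\partial_W a_1$ on $\Omega^1$. Definitions. Let $A$ be a $\mathbb C$-algebra. A differential graded algebra $(\Omega,d)$ with $\Omega^0=A$ is a *calculus* over $A$ if $\Omega^n=A\,dA\wedge\cdots\wedge dA$ ($n$ factors $dA$) for all $n\ge 0$; it is *connected* if $\ker d|_A=\mathbb C\cdot 1$, and has *dimension* $n$ if $\Omega^n\ne0$ and $\Omega^m=0$ for $m>n$. Let $\mathcal I_n$ be the space of right $A$-linear maps $\Omega^n\to A$, an $A$-bimodule by $(a\cdot\phi\cdot b)(\omega)=a\phi(b\omega)$; for $\phi\in\mathcal I_{n+m}$ and $\omega\in\Omega^n$ let $\phi\cdot\omega\in\mathcal I_m$ be $(\phi\cdot\omega)(\omega')=\phi(\omega\wedge\omega')$. A *divergence* is a linear map $\nabla:\mathcal I_1\to A$ with $\nabla(\phi\cdot a)=\nabla(\phi)a+\phi(da)$; it extends to $\nabla_n:\mathcal I_{n+1}\to\mathcal I_n$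 by $\nabla_n(\phi)(\omega)=\nabla(\phi\cdot\omega)+(-1)^{n+1}\phi(d\omega)$ (with $\nabla_0=\nabla$ under $\mathcal I_0\cong A$), and is *flat* if $\nabla\circ\nabla_1=0$. An $n$-dimensional calculus is *integrable* if there are a flat divergence $\nabla$, an algebra automorphism $\nu$ of $A$ and linear bijections $\Theta_k:\Omega^k\to\mathcal I_{n-k}$ ($0\le k\le n$) such that $\Theta_k(a\omega b)=\nu(a)\cdot\Theta_k(\omega)\cdot b$ for all $a,b\in A$, $\omega\in\Omega^k$, and $\Theta_{k+1}\circ d=\nabla_{n-k-1}\circ\Theta_k$ for $0\le k<n$. For a finitely generated algebra $A$ with finite-dimensional generating subspace $\mathcal V$, let $\mathcal V(n)$ be the span of $1$ and all words of length at most $n$ in elements of $\mathcal V$; then $\operatorname{GKdim}A=\inf\{\nu\in\mathbb R:\dim\mathcal V(n)\le n^\nu\text{ for all large }n\}$, which does not depend on $\mathcal V$. A finitely generated algebra of integer Gelfand–Kirillov dimension $n$ is *differentially smooth* if it admits an $n$-dimensional connected integrable calculus. **Theorem 3.2.** $\Omega(\mathbb P_\theta)$ is a two-dimensional connected integrable differential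 calculus over $\mathcal O(\mathbb P_\theta)$. The algebra $\mathcal O(\mathbb P_\theta)$ is finitely generated of Gelfand–Kirillov dimension $2$ and hence is differentially smooth. -/

import Mathlib

open Filter

universe u

/-- A differential graded algebra `Ω = ⨁ₙ Ωⁿ` over a field `k`, together with an identification
`ι` of `Ω⁰` with a given algebra `A`. The product of `Ω` is the wedge product. -/
structure DGAlgebraOver (k : Type u) [Field k] (A : Type u) [Ring A] [Algebra k A] where
  /-- the total space -/
  Form : Type u
  [ring : Ring Form]
  [algebra : Algebra k Form]
  /-- the component of degree `n` -/
  grade : ℕ → Submodule k Form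
  [gradedMonoid : SetLike.GradedMonoid grade]
  isInternal : DirectSum.IsInternal grade
  /-- the differential -/
  d : Form →ₗ[k] Form
  d_mem : ∀ {n : ℕ} {x : Form}, x ∈ grade n → d x ∈ grade (n + 1)
  leibniz : ∀ {n : ℕ} {x : Form} (y : Form), x ∈ grade n →
    d (x * y) = d x * y + (-1) ^ n * (x * d y)
  d_d : ∀ x : Form, d (d x) = 0
  /-- the identification of `A` with `Ω⁰` -/
  ι : A →ₐ[k] Form
  ι_injective : Function.Injective ι
  range_ι : LinearMap.range ι.toLinearMap = grade 0

namespace DGAlgebraOver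

attribute [instance] DGAlgebraOver.ring DGAlgebraOver.algebra DGAlgebraOver.gradedMonoid

variable {k : Type u} [Field k] {A : Type u} [Ring A] [Algebra k A] (Ω : DGAlgebraOver k A)

theorem ι_mem (a : A) : Ω.ι a ∈ Ω.grade 0 := by
  rw [← Ω.range_ι]; exact ⟨a, rfl⟩

/-- `Ω` is a (differential) calculus over `A`: `Ωⁿ = A dA ∧ ⋯ ∧ dA` with `n` factors `dA`. -/
def IsCalculus : Prop :=
  ∀ n : ℕ, Ω.grade n = Ω.grade 0 * ((Ω.grade 0).map Ω.d) ^ n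

/-- The kernel of `d` restricted to `A` is `k · 1`. -/
def IsConnected : Prop :=
  ∀ a : A, Ω.d (Ω.ι a) = 0 ↔ ∃ c : k, a = algebraMap k A c

/-- `Ωⁿ ≠ 0` and `Ωᵐ = 0` for `m > n`. -/
def HasDimension (n : ℕ) : Prop :=
  Ω.grade n ≠ ⊥ ∧ ∀ m : ℕ, n < m → Ω.grade m = ⊥

variable {Ω}

/-- The left action of `A` on `Ωⁿ`. -/
def lmul {n : ℕ} (a : A) (ω : Ω.grade n) : Ω.grade n :=
  ⟨Ω.ι a * ω, by simpa using SetLike.mul_mem_graded (Ω.ι_mem a) ω.2⟩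

/-- The right action of `A` on `Ωⁿ`. -/
def rmul {n : ℕ} (ω : Ω.grade n) (a : A) : Ω.grade n :=
  ⟨ω * Ω.ι a, by simpa using SetLike.mul_mem_graded ω.2 (Ω.ι_mem a)⟩

/-- The wedge product `Ωᵐ × Ωⁿ → Ωᵐ⁺ⁿ`. -/
def wedge {m n : ℕ} (ω : Ω.grade m) (ω' : Ω.grade n) : Ω.grade (m + n) :=
  ⟨ω * ω', SetLike.mul_mem_graded ω.2 ω'.2⟩

variable (Ω)

/-- The differential `Ωⁿ → Ωⁿ⁺¹`. -/
def dGrade (n : ℕ) : Ω.grade n →ₗ[k] Ω.grade (n + 1) :=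
  Ω.d.restrict fun _ hx => Ω.d_mem hx

/-- The differential `A → Ω¹`. -/
def dZero (a : A) : Ω.grade 1 := ⟨Ω.d (Ω.ι a), Ω.d_mem (Ω.ι_mem a)⟩

/-- The space `ℐₙ A` of right `A`-linear maps `Ωⁿ → A`. -/
def IntegralForm (n : ℕ) : Submodule k (Ω.grade n →ₗ[k] A) where
  carrier := {φ | ∀ (ω : Ω.grade n) (a : A), φ (rmul ω a) = φ ω * a}
  add_mem' {φ ψ} hφ hψ := by
    intro ω a
    simp only [Set.mem_ofPred_eq] at hφ hψ
    simp [hφ, hψ, add_mul]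
  zero_mem' := by intro ω a; simp
  smul_mem' c φ hφ := by
    intro ω a
    simp only [Set.mem_ofPred_eq] at hφ
    simp [hφ]

variable {Ω}

/-- `(a · φ)(ω) = a φ(ω)`. -/
def leftAct {n : ℕ} (a : A) (φ : Ω.IntegralForm n) : Ω.IntegralForm n :=
  ⟨(LinearMap.mulLeft k a).comp φ.1, fun ω b => by
    simp [φ.2 ω b, mul_assoc]⟩

/-- `(φ · b)(ω) = φ(b ω)`. -/
def rightAct {n : ℕ} (φ : Ω.IntegralForm n) (b : A) : Ω.IntegralForm n :=
  ⟨{ toFun := fun ω => φ.1 (lmul b ω)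
     map_add' := fun x y => by
      rw [← map_add]; congr 1; ext; simp [lmul, mul_add]
     map_smul' := fun c x => by
      rw [RingHom.id_apply, ← map_smul]; congr 1; ext; simp [lmul] },
    fun ω a => by
      have h := φ.2 (lmul b ω) a
      rw [LinearMap.coe_mk, AddHom.coe_mk, ← h]
      congr 1; ext; simp [lmul, rmul, mul_assoc]⟩

/-- `(φ · ω)(ω') = φ(ω ∧ ω')` for `φ ∈ ℐₙ₊ₘ A`, `ω ∈ Ωⁿ`, `ω' ∈ Ωᵐ`. -/
def formAct {n m : ℕ} (φ : Ω.IntegralForm (n + m)) (ω : Ω.grade n) : Ω.IntegralForm m :=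
  ⟨{ toFun := fun ω' => φ.1 (wedge ω ω')
     map_add' := fun x y => by
      rw [← map_add]; congr 1; ext; simp [wedge, mul_add]
     map_smul' := fun c x => by
      rw [RingHom.id_apply, ← map_smul]; congr 1; ext; simp [wedge] },
    fun ω' a => by
      have h := φ.2 (wedge ω ω') a
      rw [LinearMap.coe_mk, AddHom.coe_mk, ← h]
      congr 1; ext; simp [wedge, rmul, mul_assoc]⟩

variable (Ω)

/-- A divergence: a linear map `∇ : ℐ₁ A → A` with `∇(φ · a) = ∇(φ) a + φ(da)`. -/
structure Divergence where
  toLin : Ω.IntegralForm 1 →ₗ[k] A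
  leibniz : ∀ (φ : Ω.IntegralForm 1) (a : A),
    toLin (rightAct φ a) = toLin φ * a + φ.1 (Ω.dZero a)

variable {Ω}

/-- The extension `∇ₙ : ℐₙ₊₁ A → ℐₙ A`,
`∇ₙ(φ)(ω) = ∇(φ · ω) + (-1)ⁿ⁺¹ φ(dω)`. -/
def Divergence.ext (D : Ω.Divergence) (n : ℕ) (φ : Ω.IntegralForm (n + 1)) :
    Ω.IntegralForm n :=
  ⟨{ toFun := fun ω => D.toLin (formAct φ ω) + (-1) ^ (n + 1) * φ.1 (Ω.dGrade n ω)
     map_add' := fun x y => by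
      have h : formAct φ (x + y) = formAct φ x + formAct φ y := by
        ext ω'
        change φ.1 _ = φ.1 _ + φ.1 _
        rw [← map_add]; congr 1; ext; simp [wedge, add_mul]
      rw [h, map_add, map_add, map_add, mul_add]; abel
     map_smul' := fun c x => by
      have h : formAct φ (c • x) = c • formAct φ x := by
        ext ω'
        change φ.1 _ = c • φ.1 _
        rw [← map_smul]; congr 1; ext; simp [wedge]
      rw [h, map_smul, map_smul, map_smul, RingHom.id_apply, smul_add, mul_smul_comm] },
    fun ω a => by
      have h : formAct φ (rmul ω a) = rightAct (formAct φ ω) a := by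
        ext ω'
        change φ.1 _ = φ.1 _
        congr 1; ext; simp [wedge, rmul, lmul, mul_assoc]
      have h2 : Ω.dGrade n (rmul ω a)
          = rmul (Ω.dGrade n ω) a + (-1 : k) ^ n • wedge ω (Ω.dZero a) := by
        ext
        change Ω.d (ω.1 * Ω.ι a) = Ω.d ω.1 * Ω.ι a + (-1 : k) ^ n • (ω.1 * Ω.d (Ω.ι a))
        rw [Ω.leibniz _ ω.2]
        rcases neg_one_pow_eq_or k n with hn | hn <;>
          rcases Nat.even_or_odd n with he | he <;> simp [he.neg_one_pow]
      have h3 : (formAct φ ω).1 (Ω.dZero a) = φ.1 (wedge ω (Ω.dZero a)) := rfl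
      rw [LinearMap.coe_mk, AddHom.coe_mk, h, D.leibniz, h3, h2, map_add, map_smul, φ.2]
      rcases Nat.even_or_odd n with he | he <;>
        simp [he.neg_one_pow, pow_succ, add_mul] ; abel⟩

/-- `∇ ∘ ∇₁ = 0`. -/
def Divergence.IsFlat (D : Ω.Divergence) : Prop :=
  ∀ φ : Ω.IntegralForm 2, D.toLin (D.ext 1 φ) = 0

variable (Ω)

/-- Integrability of an `n`-dimensional calculus: there are a flat divergence `∇`, an algebra
automorphism `ν` of `A` and `A`-bimodule isomorphisms `Θₖ : Ωᵏ → ^ν ℐₙ₋ₖ A`, `k = 0, …, n`, which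
intertwine `d` with the maps `∇ₗ`. Here `l = n - k`. The algebra `A` at the right end of the
complex of integral forms is identified with `ℐ₀ A` by `a ↦ (b ↦ a b)`, under which `∇` becomes
`∇₀` (see `Divergence.ext_zero_apply`). -/
def IsIntegrable (n : ℕ) : Prop :=
  ∃ (D : Ω.Divergence) (ν : A ≃ₐ[k] A)
    (Θ : ∀ i l : ℕ, i + l = n → (Ω.grade i ≃ₗ[k] Ω.IntegralForm l)),
    D.IsFlat ∧
    (∀ (i l : ℕ) (h : i + l = n) (a b : A) (ω : Ω.grade i),
      Θ i l h (lmul a (rmul ω b)) = leftAct (ν a) (rightAct (Θ i l h ω) b)) ∧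
    (∀ (i l : ℕ) (h : i + (l + 1) = n) (ω : Ω.grade i),
      Θ (i + 1) l (by omega) (Ω.dGrade i ω) = D.ext l (Θ i (l + 1) h ω))

variable {Ω}

theorem Divergence.ext_zero_apply (D : Ω.Divergence) (φ : Ω.IntegralForm 1) (a : A) :
    (D.ext 0 φ).1 ⟨Ω.ι a, Ω.ι_mem a⟩ = D.toLin φ * a := by
  have h : formAct (n := 0) (m := 1) φ ⟨Ω.ι a, Ω.ι_mem a⟩ = rightAct φ a := rfl
  change D.toLin (formAct (n := 0) (m := 1) φ ⟨Ω.ι a, Ω.ι_mem a⟩)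
    + (-1) ^ (0 + 1) * φ.1 (Ω.dZero a) = _
  rw [h, D.leibniz]
  simp

end DGAlgebraOver

section Growth

variable (k : Type u) [Field k] {A : Type u} [Ring A] [Algebra k A]

/-- `inf {ν ∈ ℝ | dim V(n) ≤ n^ν for all large n}` (which is `⊤` if there is no such `ν`), where
`V(n) = (k 1 + V)ⁿ` is the span of the words of length at most `n` in elements of `V`. -/
noncomputable def growthExponent (V : Submodule k A) : EReal :=
  sInf ((fun ν : ℝ => (ν : EReal)) ''
    {ν : ℝ | ∀ᶠ n : ℕ in atTop,
      (Module.finrank k ((1 ⊔ V) ^ n : Submodule k A) : ℝ) ≤ (n : ℝ) ^ ν})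

variable (A)

/-- `A` is an affine (finitely generated) algebra of Gelfand-Kirillov dimension `n`, computed from
any finite-dimensional generating subspace. -/
def IsAffineOfGKDim (n : ℕ) : Prop :=
  Algebra.FiniteType k A ∧
    ∀ V : Submodule k A, FiniteDimensional k V → Algebra.adjoin k (V : Set A) = ⊤ →
      growthExponent k V = ((n : ℝ) : EReal)

/-- An affine algebra of integer Gelfand-Kirillov dimension `n` is differentially smooth if it
admits an `n`-dimensional connected integrable differential calculus. -/
def IsDifferentiallySmooth : Prop :=
  ∃ n : ℕ, IsAffineOfGKDim k A n ∧
    ∃ Ω : DGAlgebraOver k A,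
      Ω.IsCalculus ∧ Ω.HasDimension n ∧ Ω.IsConnected ∧ Ω.IsIntegrable n

end Growth

/-! ### The noncommutative torus -/

/-- Generators `V, V*, W, W*`. -/
inductive TorusGen : Type
  | V | Vs | W | Ws

/-- `λ = exp(2πiθ)`. -/
noncomputable def torusParam (θ : ℝ) : ℂ := Complex.exp (2 * Real.pi * Complex.I * θ)

/-- `V` and `W` are unitary and `VW = λWV`. (The adjoint relation `W*V* = λ̄V*W*` follows.) -/
inductive TorusRel (θ : ℝ) : FreeAlgebra ℂ TorusGen → FreeAlgebra ℂ TorusGen → Prop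
  | V_Vs : TorusRel θ (FreeAlgebra.ι ℂ .V * FreeAlgebra.ι ℂ .Vs) 1
  | Vs_V : TorusRel θ (FreeAlgebra.ι ℂ .Vs * FreeAlgebra.ι ℂ .V) 1
  | W_Ws : TorusRel θ (FreeAlgebra.ι ℂ .W * FreeAlgebra.ι ℂ .Ws) 1
  | Ws_W : TorusRel θ (FreeAlgebra.ι ℂ .Ws * FreeAlgebra.ι ℂ .W) 1
  | V_W : TorusRel θ (FreeAlgebra.ι ℂ .V * FreeAlgebra.ι ℂ .W)
      (torusParam θ • (FreeAlgebra.ι ℂ .W * FreeAlgebra.ι ℂ .V))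

/-- The coordinate algebra `𝒪(𝕋²_θ)` of the noncommutative torus. -/
def Torus (θ : ℝ) : Type := RingQuot (TorusRel θ)

namespace Torus

noncomputable instance (θ : ℝ) : Ring (Torus θ) := inferInstanceAs (Ring (RingQuot (TorusRel θ)))

noncomputable instance (θ : ℝ) : Algebra ℂ (Torus θ) :=
  inferInstanceAs (Algebra ℂ (RingQuot (TorusRel θ)))

variable {θ : ℝ}

/-- The images of the generators. -/
noncomputable def gen (g : TorusGen) : Torus θ :=
  RingQuot.mkAlgHom ℂ (TorusRel θ) (FreeAlgebra.ι ℂ g)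

theorem V_Vs : (gen .V * gen .Vs : Torus θ) = 1 := by
  have h := RingQuot.mkAlgHom_rel ℂ (TorusRel.V_Vs (θ := θ))
  rwa [map_mul, map_one] at h

theorem Vs_V : (gen .Vs * gen .V : Torus θ) = 1 := by
  have h := RingQuot.mkAlgHom_rel ℂ (TorusRel.Vs_V (θ := θ))
  rwa [map_mul, map_one] at h

theorem W_Ws : (gen .W * gen .Ws : Torus θ) = 1 := by
  have h := RingQuot.mkAlgHom_rel ℂ (TorusRel.W_Ws (θ := θ))
  rwa [map_mul, map_one] at h

theorem Ws_W : (gen .Ws * gen .W : Torus θ) = 1 := by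
  have h := RingQuot.mkAlgHom_rel ℂ (TorusRel.Ws_W (θ := θ))
  rwa [map_mul, map_one] at h

theorem V_W : (gen .V * gen .W : Torus θ) = torusParam θ • (gen .W * gen .V) := by
  have h := RingQuot.mkAlgHom_rel ℂ (TorusRel.V_W (θ := θ))
  rwa [map_mul, map_smul, map_mul] at h

theorem Vs_Ws : (gen .Vs * gen .Ws : Torus θ) = torusParam θ • (gen .Ws * gen .Vs) := by
  have h := congrArg (fun t : Torus θ => gen .Ws * gen .Vs * t * (gen .Vs * gen .Ws))
    (V_W (θ := θ))
  have e1 : (gen .Ws * gen .Vs * (gen .V * gen .W) * (gen .Vs * gen .Ws) : Torus θ)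
      = gen .Vs * gen .Ws := by
    calc _ = (gen .Ws * (gen .Vs * gen .V) * gen .W * (gen .Vs * gen .Ws) : Torus θ) := by
          noncomm_ring
      _ = gen .Vs * gen .Ws := by rw [Vs_V, mul_one, Ws_W, one_mul]
  have e2 : (gen .Ws * gen .Vs * (gen .W * gen .V) * (gen .Vs * gen .Ws) : Torus θ)
      = gen .Ws * gen .Vs := by
    calc _ = (gen .Ws * gen .Vs * (gen .W * (gen .V * gen .Vs) * gen .Ws) : Torus θ) := by
          noncomm_ring
      _ = gen .Ws * gen .Vs := by rw [V_Vs, mul_one, W_Ws, mul_one]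
  simpa only [mul_smul_comm, smul_mul_assoc, e1, e2] using h

/-- Algebra maps out of `𝒪(𝕋²_θ)`. -/
noncomputable def lift {B : Type*} [Ring B] [Algebra ℂ B] (f : TorusGen → B)
    (h1 : f .V * f .Vs = 1) (h2 : f .Vs * f .V = 1) (h3 : f .W * f .Ws = 1)
    (h4 : f .Ws * f .W = 1) (h5 : f .V * f .W = torusParam θ • (f .W * f .V)) :
    Torus θ →ₐ[ℂ] B :=
  RingQuot.liftAlgHom ℂ ⟨FreeAlgebra.lift ℂ f, by
    intro x y h
    cases h <;> simp [h1, h2, h3, h4, h5]⟩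

@[simp]
theorem lift_gen {B : Type*} [Ring B] [Algebra ℂ B] (f : TorusGen → B) (h1 h2 h3 h4 h5)
    (g : TorusGen) : lift (θ := θ) f h1 h2 h3 h4 h5 (gen g) = f g := by
  unfold lift gen
  exact (RingQuot.liftAlgHom_mkAlgHom_apply ℂ _ _ _).trans (by simp)

@[elab_as_elim]
theorem induction {P : Torus θ → Prop} (halg : ∀ c : ℂ, P (algebraMap ℂ _ c))
    (hgen : ∀ g, P (gen g)) (hmul : ∀ a b, P a → P b → P (a * b))
    (hadd : ∀ a b, P a → P b → P (a + b)) (a : Torus θ) : P a := by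
  obtain ⟨x, rfl⟩ := RingQuot.mkAlgHom_surjective ℂ (TorusRel θ) a
  induction x using FreeAlgebra.induction with
  | grade0 c => rw [AlgHom.commutes]; exact halg c
  | grade1 g => exact hgen g
  | mul a b ha hb => rw [map_mul]; exact hmul _ _ ha hb
  | add a b ha hb => rw [map_add]; exact hadd _ _ ha hb

/-- The algebra automorphism `σ`, `V ↦ V*`, `W ↦ W*`. -/
noncomputable def sigma : Torus θ →ₐ[ℂ] Torus θ :=
  lift (fun
    | .V => gen .Vs
    | .Vs => gen .V
    | .W => gen .Ws
    | .Ws => gen .W) Vs_V V_Vs Ws_W W_Ws Vs_Ws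

/-- `a ↦ a + ε ∂(a)`, where `∂` is the derivation with `∂(V) = p V`, `∂(W) = q W`. -/
noncomputable def derHom (p q : ℂ) : Torus θ →ₐ[ℂ] TrivSqZeroExt (Torus θ) (Torus θ) :=
  lift (fun
    | .V => TrivSqZeroExt.inl (gen .V) + TrivSqZeroExt.inr (p • gen .V)
    | .Vs => TrivSqZeroExt.inl (gen .Vs) + TrivSqZeroExt.inr (-(p • gen .Vs))
    | .W => TrivSqZeroExt.inl (gen .W) + TrivSqZeroExt.inr (q • gen .W)
    | .Ws => TrivSqZeroExt.inl (gen .Ws) + TrivSqZeroExt.inr (-(q • gen .Ws)))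
    (by ext <;> simp [V_Vs])
    (by ext <;> simp [Vs_V])
    (by ext <;> simp [W_Ws])
    (by ext <;> simp [Ws_W])
    (by
      ext
      · simp [V_W]
      · simp only [TrivSqZeroExt.snd_mul, TrivSqZeroExt.snd_smul, TrivSqZeroExt.fst_add,
          TrivSqZeroExt.snd_add, TrivSqZeroExt.fst_inl, TrivSqZeroExt.snd_inl,
          TrivSqZeroExt.fst_inr, TrivSqZeroExt.snd_inr, add_zero, zero_add, smul_eq_mul,
          MulOpposite.smul_eq_mul_unop, MulOpposite.unop_op, mul_smul_comm, smul_mul_assoc, V_W]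
        module)

/-- The derivation `∂` of `𝒪(𝕋²_θ)` with `∂(V) = p V`, `∂(W) = q W`. -/
noncomputable def der (p q : ℂ) : Torus θ →ₗ[ℂ] Torus θ :=
  (TrivSqZeroExt.sndHom (Torus θ) (Torus θ) |>.restrictScalars ℂ).comp (derHom p q).toLinearMap

theorem der_def (p q : ℂ) (a : Torus θ) : der p q a = (derHom p q a).snd := rfl

theorem derHom_fst (p q : ℂ) (a : Torus θ) : (derHom p q a).fst = a := by
  induction a using Torus.induction with
  | halg c => rw [AlgHom.commutes]; rfl
  | hgen g => rw [derHom, lift_gen]; cases g <;> simp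
  | hmul a b ha hb => rw [map_mul, TrivSqZeroExt.fst_mul, ha, hb]
  | hadd a b ha hb => rw [map_add, TrivSqZeroExt.fst_add, ha, hb]

theorem der_mul (p q : ℂ) (a b : Torus θ) :
    der p q (a * b) = der p q a * b + a * der p q b := by
  simp only [der_def]
  rw [map_mul, TrivSqZeroExt.snd_mul, derHom_fst, derHom_fst, add_comm]
  simp [MulOpposite.smul_eq_mul_unop]

theorem der_algebraMap (p q c : ℂ) : der p q (algebraMap ℂ (Torus θ) c) = 0 := by
  rw [der_def, AlgHom.commutes]; rfl

/-- `∂_V`, with `∂_V(VᵐWⁿ) = i m VᵐWⁿ`. -/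
noncomputable def derV : Torus θ →ₗ[ℂ] Torus θ := der Complex.I 0

/-- `∂_W`, with `∂_W(VᵐWⁿ) = i n VᵐWⁿ`. -/
noncomputable def derW : Torus θ →ₗ[ℂ] Torus θ := der 0 Complex.I

/-- The unitary `V`. -/
noncomputable def unitV : (Torus θ)ˣ := ⟨gen .V, gen .Vs, V_Vs, Vs_V⟩

/-- The unitary `W`. -/
noncomputable def unitW : (Torus θ)ˣ := ⟨gen .W, gen .Ws, W_Ws, Ws_W⟩

theorem der_gen (p q : ℂ) (g : TorusGen) :
    der p q (gen g : Torus θ) = (match g with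
      | .V => p
      | .Vs => -p
      | .W => q
      | .Ws => -q) • gen g := by
  rw [der_def, derHom, lift_gen]
  cases g <;> simp

theorem der_unit_zpow (p q c : ℂ) (u : (Torus θ)ˣ) (hu : der p q (u : Torus θ) = c • (u : Torus θ))
    (hu' : der p q ((u⁻¹ : (Torus θ)ˣ) : Torus θ) = (-c) • ((u⁻¹ : (Torus θ)ˣ) : Torus θ))
    (m : ℤ) : der p q ((u ^ m : (Torus θ)ˣ) : Torus θ) = (m * c) • ((u ^ m : (Torus θ)ˣ) : Torus θ) := by
  induction m with
  | zero =>
    simpa using der_algebraMap (θ := θ) p q 1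
  | succ n ih =>
    rw [zpow_add_one, Units.val_mul, der_mul, ih, hu, smul_mul_assoc, mul_smul_comm, ← add_smul]
    congr 1; push_cast; ring
  | pred n ih =>
    rw [zpow_sub_one, Units.val_mul, der_mul, ih, hu', smul_mul_assoc, mul_smul_comm, ← add_smul]
    congr 1; push_cast; ring

theorem der_monomial (p q : ℂ) (m n : ℤ) :
    der p q ((unitV ^ m * unitW ^ n : (Torus θ)ˣ) : Torus θ)
      = (m * p + n * q) • ((unitV ^ m * unitW ^ n : (Torus θ)ˣ) : Torus θ) := by
  rw [Units.val_mul, der_mul, der_unit_zpow p q p unitV (der_gen p q .V) (der_gen p q .Vs),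
    der_unit_zpow p q q unitW (der_gen p q .W) (der_gen p q .Ws), smul_mul_assoc, mul_smul_comm,
    ← add_smul]

theorem derV_monomial (m n : ℤ) :
    derV ((unitV ^ m * unitW ^ n : (Torus θ)ˣ) : Torus θ)
      = (Complex.I * m) • ((unitV ^ m * unitW ^ n : (Torus θ)ˣ) : Torus θ) := by
  rw [derV, der_monomial]; congr 1; ring

theorem derW_monomial (m n : ℤ) :
    derW ((unitV ^ m * unitW ^ n : (Torus θ)ˣ) : Torus θ)
      = (Complex.I * n) • ((unitV ^ m * unitW ^ n : (Torus θ)ˣ) : Torus θ) := by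
  rw [derW, der_monomial]; congr 1; ring

theorem der_comm (p q p' q' : ℂ) (a : Torus θ) :
    der p q (der p' q' a) = der p' q' (der p q a) := by
  induction a using Torus.induction with
  | halg c => simp [der_algebraMap]
  | hgen g => cases g <;> simp only [der_gen, map_smul, smul_smul, mul_comm]
  | hmul a b ha hb => simp only [der_mul, map_add, ha, hb]; abel
  | hadd a b ha hb => simp only [map_add, ha, hb]

theorem der_sigma (p q : ℂ) (a : Torus θ) : der p q (sigma a) = -sigma (der p q a) := by
  induction a using Torus.induction with
  | halg c => simp [der_algebraMap]
  | hgen g => cases g <;> simp [sigma, der_gen]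
  | hmul a b ha hb => simp only [der_mul, map_mul, map_add, ha, hb]; noncomm_ring
  | hadd a b ha hb => simp only [map_add, ha, hb]; abel

end Torus

/-! ### The noncommutative pillow and its calculus -/

/-- `𝒪(ℙ_θ) = 𝒪(𝕋²_θ)₊`, the algebra of `σ`-invariant elements. -/
noncomputable def Pillow (θ : ℝ) : Subalgebra ℂ (Torus θ) :=
  AlgHom.equalizer Torus.sigma (AlgHom.id ℂ (Torus θ))

/-- `𝒪(𝕋²_θ)₋`, the space of all `a` with `σ(a) = -a`. -/
noncomputable def Minus (θ : ℝ) : Submodule ℂ (Torus θ) :=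
  LinearMap.eqLocus Torus.sigma.toLinearMap (-LinearMap.id)

theorem mem_pillow {θ : ℝ} {a : Torus θ} : a ∈ Pillow θ ↔ Torus.sigma a = a := Iff.rfl

theorem mem_minus {θ : ℝ} {a : Torus θ} : a ∈ Minus θ ↔ Torus.sigma a = -a := Iff.rfl

/-- The total space `Ω(ℙ_θ) = Ω⁰ ⊕ Ω¹ ⊕ Ω²`, where `Ω⁰ = 𝒪(ℙ_θ)`,
`Ω¹ = 𝒪(𝕋²_θ)₋ ⊕ 𝒪(𝕋²_θ)₋` and `Ω² = 𝒪(ℙ_θ)`. -/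
def PillowForm (θ : ℝ) : Type := Pillow θ × (Minus θ × Minus θ) × Pillow θ

namespace PillowForm

variable {θ : ℝ}

noncomputable instance : AddCommGroup (PillowForm θ) :=
  inferInstanceAs (AddCommGroup (Pillow θ × (Minus θ × Minus θ) × Pillow θ))

noncomputable instance : Module ℂ (PillowForm θ) :=
  inferInstanceAs (Module ℂ (Pillow θ × (Minus θ × Minus θ) × Pillow θ))

/-- The component in `Ω⁰`. -/
def f0 (x : PillowForm θ) : Torus θ := x.1

/-- The first component in `Ω¹`. -/
def fV (x : PillowForm θ) : Torus θ := x.2.1.1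

/-- The second component in `Ω¹`. -/
def fW (x : PillowForm θ) : Torus θ := x.2.1.2

/-- The component in `Ω²`. -/
def f2 (x : PillowForm θ) : Torus θ := x.2.2

theorem sigma_f0 (x : PillowForm θ) : Torus.sigma x.f0 = x.f0 := x.1.2
theorem sigma_fV (x : PillowForm θ) : Torus.sigma x.fV = -x.fV := x.2.1.1.2
theorem sigma_fW (x : PillowForm θ) : Torus.sigma x.fW = -x.fW := x.2.1.2.2
theorem sigma_f2 (x : PillowForm θ) : Torus.sigma x.f2 = x.f2 := x.2.2.2

@[ext]
theorem ext {x y : PillowForm θ} (h0 : x.f0 = y.f0) (hV : x.fV = y.fV) (hW : x.fW = y.fW)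
    (h2 : x.f2 = y.f2) : x = y :=
  Prod.ext (Subtype.ext h0)
    (Prod.ext (Prod.ext (Subtype.ext hV) (Subtype.ext hW)) (Subtype.ext h2))

/-- The form with components `a ∈ Ω⁰`, `(b, c) ∈ Ω¹`, `e ∈ Ω²`. -/
def mk (a b c e : Torus θ) (ha : Torus.sigma a = a) (hb : Torus.sigma b = -b)
    (hc : Torus.sigma c = -c) (he : Torus.sigma e = e) : PillowForm θ :=
  (⟨a, ha⟩, (⟨b, hb⟩, ⟨c, hc⟩), ⟨e, he⟩)

section mk
variable (a b c e : Torus θ) (ha hb hc he)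
@[simp] theorem f0_mk : (mk a b c e ha hb hc he).f0 = a := rfl
@[simp] theorem fV_mk : (mk a b c e ha hb hc he).fV = b := rfl
@[simp] theorem fW_mk : (mk a b c e ha hb hc he).fW = c := rfl
@[simp] theorem f2_mk : (mk a b c e ha hb hc he).f2 = e := rfl
end mk

section add
variable (x y : PillowForm θ) (c : ℂ)
@[simp] theorem f0_add : (x + y).f0 = x.f0 + y.f0 := rfl
@[simp] theorem fV_add : (x + y).fV = x.fV + y.fV := rfl
@[simp] theorem fW_add : (x + y).fW = x.fW + y.fW := rfl
@[simp] theorem f2_add : (x + y).f2 = x.f2 + y.f2 := rfl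
@[simp] theorem f0_smul : (c • x).f0 = c • x.f0 := rfl
@[simp] theorem fV_smul : (c • x).fV = c • x.fV := rfl
@[simp] theorem fW_smul : (c • x).fW = c • x.fW := rfl
@[simp] theorem f2_smul : (c • x).f2 = c • x.f2 := rfl
@[simp] theorem f0_neg : (-x).f0 = -x.f0 := rfl
@[simp] theorem fV_neg : (-x).fV = -x.fV := rfl
@[simp] theorem fW_neg : (-x).fW = -x.fW := rfl
@[simp] theorem f2_neg : (-x).f2 = -x.f2 := rfl
@[simp] theorem f0_zero : (0 : PillowForm θ).f0 = 0 := rfl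
@[simp] theorem fV_zero : (0 : PillowForm θ).fV = 0 := rfl
@[simp] theorem fW_zero : (0 : PillowForm θ).fW = 0 := rfl
@[simp] theorem f2_zero : (0 : PillowForm θ).f2 = 0 := rfl
end add

noncomputable instance : One (PillowForm θ) :=
  ⟨mk 1 0 0 0 (by simp) (by simp) (by simp) (by simp)⟩

/-- The wedge product: the product of the torus algebra in each slot, with
`(a₁, a₂) ∧ (a₃, a₄) = a₁ a₄ - a₂ a₃` on `Ω¹`. -/
noncomputable instance : Mul (PillowForm θ) :=
  ⟨fun x y => mk (x.f0 * y.f0) (x.f0 * y.fV + x.fV * y.f0) (x.f0 * y.fW + x.fW * y.f0)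
    (x.f0 * y.f2 + (x.fV * y.fW - x.fW * y.fV) + x.f2 * y.f0)
    (by simp [sigma_f0])
    (by simp only [map_add, map_mul, sigma_f0, sigma_fV]; noncomm_ring)
    (by simp only [map_add, map_mul, sigma_f0, sigma_fW]; noncomm_ring)
    (by simp only [map_add, map_sub, map_mul, sigma_f0, sigma_fV, sigma_fW, sigma_f2]
        noncomm_ring)⟩

section mul
variable (x y : PillowForm θ)
@[simp] theorem f0_one : (1 : PillowForm θ).f0 = 1 := rfl
@[simp] theorem fV_one : (1 : PillowForm θ).fV = 0 := rfl
@[simp] theorem fW_one : (1 : PillowForm θ).fW = 0 := rfl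
@[simp] theorem f2_one : (1 : PillowForm θ).f2 = 0 := rfl
@[simp] theorem f0_mul : (x * y).f0 = x.f0 * y.f0 := rfl
@[simp] theorem fV_mul : (x * y).fV = x.f0 * y.fV + x.fV * y.f0 := rfl
@[simp] theorem fW_mul : (x * y).fW = x.f0 * y.fW + x.fW * y.f0 := rfl
@[simp] theorem f2_mul :
    (x * y).f2 = x.f0 * y.f2 + (x.fV * y.fW - x.fW * y.fV) + x.f2 * y.f0 := rfl
end mul

noncomputable instance : Ring (PillowForm θ) :=
  { (inferInstance : AddCommGroup (PillowForm θ)) with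
    mul := (· * ·)
    one := 1
    mul_assoc := fun x y z => by
      ext <;> simp only [f0_mul, fV_mul, fW_mul, f2_mul] <;> noncomm_ring
    one_mul := fun x => by ext <;> simp
    mul_one := fun x => by ext <;> simp
    zero_mul := fun x => by ext <;> simp
    mul_zero := fun x => by ext <;> simp
    left_distrib := fun x y z => by
      ext <;> simp only [f0_mul, fV_mul, fW_mul, f2_mul, f0_add, fV_add, fW_add, f2_add] <;>
        noncomm_ring
    right_distrib := fun x y z => by
      ext <;> simp only [f0_mul, fV_mul, fW_mul, f2_mul, f0_add, fV_add, fW_add, f2_add] <;>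
        noncomm_ring }

noncomputable instance : Algebra ℂ (PillowForm θ) :=
  Algebra.ofModule
    (fun c x y => by ext <;> simp [smul_add, smul_sub])
    (fun c x y => by ext <;> simp [smul_add, smul_sub])

variable (θ)

/-- `Ω⁰ = 𝒪(ℙ_θ)`, `Ω¹ = 𝒪(𝕋²_θ)₋ ⊕ 𝒪(𝕋²_θ)₋`, `Ω² = 𝒪(ℙ_θ)` and `Ωⁿ = 0` for `n > 2`, as
subspaces of the total space. -/
noncomputable def grade : ℕ → Submodule ℂ (PillowForm θ)
  | 0 =>
    { carrier := {x | x.fV = 0 ∧ x.fW = 0 ∧ x.f2 = 0}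
      add_mem' := by rintro x y ⟨h1, h2, h3⟩ ⟨h4, h5, h6⟩; simp [*]
      zero_mem' := by simp
      smul_mem' := by rintro c x ⟨h1, h2, h3⟩; simp [*] }
  | 1 =>
    { carrier := {x | x.f0 = 0 ∧ x.f2 = 0}
      add_mem' := by rintro x y ⟨h1, h2⟩ ⟨h3, h4⟩; simp [*]
      zero_mem' := by simp
      smul_mem' := by rintro c x ⟨h1, h2⟩; simp [*] }
  | 2 =>
    { carrier := {x | x.f0 = 0 ∧ x.fV = 0 ∧ x.fW = 0}
      add_mem' := by rintro x y ⟨h1, h2, h3⟩ ⟨h4, h5, h6⟩; simp [*]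
      zero_mem' := by simp
      smul_mem' := by rintro c x ⟨h1, h2, h3⟩; simp [*] }
  | _ + 3 => ⊥

variable {θ}

theorem mem_grade_zero {x : PillowForm θ} :
    x ∈ grade θ 0 ↔ x.fV = 0 ∧ x.fW = 0 ∧ x.f2 = 0 := Iff.rfl

theorem mem_grade_one {x : PillowForm θ} : x ∈ grade θ 1 ↔ x.f0 = 0 ∧ x.f2 = 0 := Iff.rfl

theorem mem_grade_two {x : PillowForm θ} :
    x ∈ grade θ 2 ↔ x.f0 = 0 ∧ x.fV = 0 ∧ x.fW = 0 := Iff.rfl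

theorem mem_grade_add_three {n : ℕ} {x : PillowForm θ} : x ∈ grade θ (n + 3) ↔ x = 0 := Iff.rfl

instance : SetLike.GradedMonoid (grade θ) where
  one_mem := by simp [mem_grade_zero]
  mul_mem := by
    intro i j x y hx hy
    match i, j with
    | 0, 0 => obtain ⟨_, _, _⟩ := hx; obtain ⟨_, _, _⟩ := hy; simp [mem_grade_zero, *]
    | 0, 1 => obtain ⟨_, _, _⟩ := hx; obtain ⟨_, _⟩ := hy; simp [mem_grade_one, *]
    | 0, 2 => obtain ⟨_, _, _⟩ := hx; obtain ⟨_, _, _⟩ := hy; simp [mem_grade_two, *]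
    | 1, 0 => obtain ⟨_, _⟩ := hx; obtain ⟨_, _, _⟩ := hy; simp [mem_grade_one, *]
    | 1, 1 => obtain ⟨_, _⟩ := hx; obtain ⟨_, _⟩ := hy; simp [mem_grade_two, *]
    | 2, 0 => obtain ⟨_, _, _⟩ := hx; obtain ⟨_, _, _⟩ := hy; simp [mem_grade_two, *]
    | 1, 2 =>
      obtain ⟨_, _⟩ := hx; obtain ⟨_, _, _⟩ := hy
      refine (mem_grade_add_three (n := 0)).2 ?_
      ext <;> simp [*]
    | 2, 1 =>
      obtain ⟨_, _, _⟩ := hx; obtain ⟨_, _⟩ := hy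
      refine (mem_grade_add_three (n := 0)).2 ?_
      ext <;> simp [*]
    | 2, 2 =>
      obtain ⟨_, _, _⟩ := hx; obtain ⟨_, _, _⟩ := hy
      refine (mem_grade_add_three (n := 1)).2 ?_
      ext <;> simp [*]
    | n + 3, j =>
      rw [mem_grade_add_three] at hx
      rw [hx, zero_mul]; exact Submodule.zero_mem _
    | i, n + 3 =>
      rw [mem_grade_add_three] at hy
      rw [hy, mul_zero]; exact Submodule.zero_mem _

/-- The decomposition of a form into its homogeneous components. -/
noncomputable def decompose :
    PillowForm θ →ₗ[ℂ] DirectSum ℕ fun i => grade θ i where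
  toFun x :=
    DirectSum.lof ℂ ℕ (fun i => grade θ i) 0
      ⟨mk x.f0 0 0 0 x.sigma_f0 (by simp) (by simp) (by simp), by simp [mem_grade_zero]⟩ +
    DirectSum.lof ℂ ℕ (fun i => grade θ i) 1
      ⟨mk 0 x.fV x.fW 0 (by simp) x.sigma_fV x.sigma_fW (by simp), by simp [mem_grade_one]⟩ +
    DirectSum.lof ℂ ℕ (fun i => grade θ i) 2
      ⟨mk 0 0 0 x.f2 (by simp) (by simp) (by simp) x.sigma_f2, by simp [mem_grade_two]⟩
  map_add' x y := by
    rw [show ∀ a b c a' b' c' : DirectSum ℕ fun i => grade θ i,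
      a + b + c + (a' + b' + c') = (a + a') + (b + b') + (c + c') by intros; abel]
    simp only [← map_add]
    congr 1
    · congr 1
      · congr 1; apply Subtype.ext; apply PillowForm.ext <;> simp
      · congr 1; apply Subtype.ext; apply PillowForm.ext <;> simp
    · congr 1; apply Subtype.ext; apply PillowForm.ext <;> simp
  map_smul' c x := by
    simp only [RingHom.id_apply, smul_add, ← map_smul]
    congr 1
    · congr 1
      · congr 1; apply Subtype.ext; apply PillowForm.ext <;> simp
      · congr 1; apply Subtype.ext; apply PillowForm.ext <;> simp
    · congr 1; apply Subtype.ext; apply PillowForm.ext <;> simp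

theorem isInternal : DirectSum.IsInternal (grade θ) := by
  let _ : DirectSum.Decomposition (grade θ) :=
    DirectSum.Decomposition.ofLinearMap (grade θ) decompose
      (by
        refine LinearMap.ext fun x => ?_
        simp only [LinearMap.comp_apply, decompose, LinearMap.coe_mk, AddHom.coe_mk, map_add,
          DirectSum.coeLinearMap_lof]
        ext <;> simp)
      (by
        refine DirectSum.linearMap_ext _ fun i => LinearMap.ext fun x => ?_
        simp only [LinearMap.comp_apply, DirectSum.coeLinearMap_lof, LinearMap.id_apply]
        obtain ⟨x, hx⟩ := x
        have key : ∀ (i : ℕ) (y z : grade θ i), y.1 = z.1 →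
            DirectSum.lof ℂ ℕ (fun i => grade θ i) i y
              = DirectSum.lof ℂ ℕ (fun i => grade θ i) i z :=
          fun i y z h => congrArg _ (Subtype.ext h)
        match i with
        | 0 =>
          obtain ⟨h1, h2, h3⟩ := id hx
          refine (congrArg₂ (· + ·) (congrArg₂ (· + ·) (key 0 _ ⟨x, hx⟩ ?_) (key 1 _ 0 ?_))
            (key 2 _ 0 ?_)).trans (by simp; rfl) <;> ext <;> simp [*]
        | 1 =>
          obtain ⟨h1, h2⟩ := id hx
          refine (congrArg₂ (· + ·) (congrArg₂ (· + ·) (key 0 _ 0 ?_) (key 1 _ ⟨x, hx⟩ ?_))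
            (key 2 _ 0 ?_)).trans (by simp; rfl) <;> ext <;> simp [*]
        | 2 =>
          obtain ⟨h1, h2, h3⟩ := id hx
          refine (congrArg₂ (· + ·) (congrArg₂ (· + ·) (key 0 _ 0 ?_) (key 1 _ 0 ?_))
            (key 2 _ ⟨x, hx⟩ ?_)).trans (by simp; rfl) <;> ext <;> simp [*]
        | n + 3 =>
          have h0 := mem_grade_add_three.1 hx
          rw [key (n + 3) ⟨x, hx⟩ 0 h0, map_zero]
          exact (congrArg _ h0).trans (map_zero _))
  exact DirectSum.Decomposition.isInternal _

/-- The differential: `a ↦ (∂_V a, ∂_W a)` on `Ω⁰` and `(a₁, a₂) ↦ ∂_V a₂ - ∂_W a₁` on `Ω¹`. -/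
noncomputable def d : PillowForm θ →ₗ[ℂ] PillowForm θ where
  toFun x := mk 0 (Torus.derV x.f0) (Torus.derW x.f0) (Torus.derV x.fW - Torus.derW x.fV)
    (by simp)
    (by rw [← neg_eq_iff_eq_neg, Torus.derV, ← Torus.der_sigma, sigma_f0])
    (by rw [← neg_eq_iff_eq_neg, Torus.derW, ← Torus.der_sigma, sigma_f0])
    (by
      have h1 := Torus.der_sigma Complex.I 0 x.fW
      have h2 := Torus.der_sigma 0 Complex.I x.fV
      rw [sigma_fW, map_neg, neg_inj] at h1
      rw [sigma_fV, map_neg, neg_inj] at h2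
      rw [map_sub, Torus.derV, Torus.derW, ← h1, ← h2])
  map_add' x y := by ext <;> simp; abel
  map_smul' c x := by ext <;> simp [smul_sub]

section d
variable (x : PillowForm θ)
@[simp] theorem f0_d : (d x).f0 = 0 := rfl
@[simp] theorem fV_d : (d x).fV = Torus.derV x.f0 := rfl
@[simp] theorem fW_d : (d x).fW = Torus.derW x.f0 := rfl
@[simp] theorem f2_d : (d x).f2 = Torus.derV x.fW - Torus.derW x.fV := rfl
end d

/-- The inclusion of `𝒪(ℙ_θ)` as `Ω⁰`. -/
noncomputable def incl : Pillow θ →ₐ[ℂ] PillowForm θ :=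
  AlgHom.ofLinearMap
    { toFun := fun a => mk a 0 0 0 (mem_pillow.1 a.2) (by simp) (by simp) (by simp)
      map_add' := fun a b => by ext <;> simp
      map_smul' := fun c a => by ext <;> simp }
    (by ext <;> simp)
    (fun a b => by ext <;> simp)

end PillowForm

/-- The differential graded algebra `Ω(ℙ_θ)` over `𝒪(ℙ_θ)`. -/
noncomputable def pillowCalculus (θ : ℝ) : DGAlgebraOver ℂ (Pillow θ) where
  Form := PillowForm θ
  grade := PillowForm.grade θ
  isInternal := PillowForm.isInternal
  d := PillowForm.d
  d_mem := by
    intro n x hx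
    match n with
    | 0 => obtain ⟨_, _, _⟩ := hx; simp [PillowForm.mem_grade_one, *]
    | 1 => obtain ⟨_, _⟩ := hx; simp [PillowForm.mem_grade_two, *]
    | 2 =>
      obtain ⟨_, _, _⟩ := hx
      refine (PillowForm.mem_grade_add_three (n := 0)).2 ?_
      ext <;> simp [*]
    | n + 3 =>
      rw [PillowForm.mem_grade_add_three] at hx
      rw [hx, map_zero]; exact Submodule.zero_mem _
  leibniz := by
    intro n x y hx
    match n with
    | 0 =>
      obtain ⟨h1, h2, h3⟩ := hx
      ext <;> simp [h1, h2, h3, Torus.derV, Torus.derW, Torus.der_mul]; noncomm_ring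
    | 1 =>
      obtain ⟨h1, h2⟩ := hx
      ext <;> simp [h1, h2, Torus.derV, Torus.derW, Torus.der_mul] ; noncomm_ring
    | 2 =>
      obtain ⟨h1, h2, h3⟩ := hx
      ext <;> simp [h1, h2, h3]
    | n + 3 =>
      rw [PillowForm.mem_grade_add_three] at hx
      simp [hx]
  d_d := by
    intro x
    ext <;> simp [Torus.derV, Torus.derW]
    rw [Torus.der_comm, sub_self]
  ι := PillowForm.incl
  ι_injective := fun a b h => Subtype.ext (congrArg PillowForm.f0 h)
  range_ι := by
    ext x
    constructor
    · rintro ⟨a, rfl⟩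
      exact ⟨rfl, rfl, rfl⟩
    · rintro ⟨h1, h2, h3⟩
      exact ⟨⟨x.f0, x.sigma_f0⟩, PillowForm.ext rfl h1.symm h2.symm h3.symm⟩

/-!
Write `E^ε_x = VᵐWⁿ + ε V⁻ᵐW⁻ⁿ` for `x = (m, n)` and `ε = ±1`; the even and the odd part of the
torus are spanned by the `E^+_x` and the `E^-_x`. Both products `E^ε_x E^δ_y` and `E^δ_y E^ε_x` are
combinations of `E^{εδ}_{x+y}` and `E^{εδ}_{x-y}`, and since `λ` is not a root of unity the two
combinations are independent as soon as `x` and `y` are not parallel. Hence a space containing both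
products contains `E^{εδ}_{x+y}`. This yields three facts:

* the form `d(E^+_x) = i (m E^-_x, n E^-_x)` generates all `(m a, n a)` with `a` odd as a bimodule
  over the pillow algebra, so `Ω¹ = A dA`;
* `1` is a sum of products of two odd elements, so `Ω² = Ω¹ ∧ Ω¹` and the wedge product is a perfect
  pairing of `Ω¹` with itself;
* `V + V*` and `W + W*` generate the pillow algebra, and `E^+_{(m,n)}` is reached by words of length
  `m + n`, so that the growth is exactly quadratic.

Perfectness of the pairings `Ωᵏ × Ω²⁻ᵏ → Ω² = A` identifies forms with integral forms, and `d`,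
carried over to the integral forms, is a flat divergence.
-/

/-! ### Monomials -/

theorem torusParam_ne_zero (θ : ℝ) : torusParam θ ≠ 0 := Complex.exp_ne_zero _

theorem torusParam_zpow_injective {θ : ℝ} (hθ : Irrational θ) :
    Function.Injective fun n : ℤ => torusParam θ ^ n := by
  intro m n hmn
  simp only [torusParam, ← Complex.exp_int_mul] at hmn
  obtain ⟨l, hl⟩ := Complex.exp_eq_exp_iff_exists_int.1 hmn
  have hsub : ((m - n : ℤ) * θ : ℂ) = l := by
    apply mul_right_cancel₀ Complex.two_pi_I_ne_zero
    push_cast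
    linear_combination hl
  by_contra hne
  exact (hθ.intCast_mul (sub_ne_zero.2 hne)).ne_int l (mod_cast hsub)

theorem zpow_mul_zpow_of_mul_eq {G : Type*} [Group G] {c v w : G} (hcv : Commute c v)
    (hcw : Commute c w) (h : v * w = c * (w * v)) (m n : ℤ) :
    w ^ n * v ^ m = c ^ (-(n * m)) * (v ^ m * w ^ n) := by
  have hv : SemiconjBy v (w ^ n) (c ^ n * w ^ n) := by
    rw [← hcw.mul_zpow]
    exact SemiconjBy.zpow_right (h.trans (mul_assoc _ _ _).symm) n
  have hw : SemiconjBy (w ^ n) v (c ^ (-n) * v) := by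
    rw [SemiconjBy, mul_assoc, hv.eq, ← mul_assoc, ← mul_assoc, zpow_neg, inv_mul_cancel, one_mul]
  rw [(hw.zpow_right m).eq, (hcv.zpow_left (-n)).mul_zpow, ← zpow_mul, neg_mul, mul_assoc]

namespace Torus

variable {θ : ℝ}

/-- The monomial `VᵐWⁿ` with exponent `x = (m, n)`. -/
noncomputable def monomial (x : ℤ × ℤ) : Torus θ := ↑(unitV ^ x.1 * unitW ^ x.2 : (Torus θ)ˣ)

theorem monomial_zero : (monomial 0 : Torus θ) = 1 := by simp [monomial]

theorem unitW_zpow_mul_unitV_zpow (m n : ℤ) :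
    (↑(unitW ^ n * unitV ^ m : (Torus θ)ˣ) : Torus θ) =
      torusParam θ ^ (-(n * m)) • ↑(unitV ^ m * unitW ^ n : (Torus θ)ˣ) := by
  let c : (Torus θ)ˣ :=
    Units.map (algebraMap ℂ (Torus θ)).toMonoidHom (Units.mk0 _ (torusParam_ne_zero θ))
  have hc (u : (Torus θ)ˣ) : Commute c u := Units.ext (Algebra.commutes _ _)
  have hvw : (unitV * unitW : (Torus θ)ˣ) = c * (unitW * unitV) :=
    Units.ext (V_W.trans (Algebra.smul_def _ _))
  rw [zpow_mul_zpow_of_mul_eq (hc _) (hc _) hvw, Units.val_mul (c ^ _), Algebra.smul_def,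
    ← map_zpow, Units.coe_map]
  simp

theorem monomial_mul (x y : ℤ × ℤ) : (monomial x * monomial y : Torus θ) =
    torusParam θ ^ (-(x.2 * y.1)) • monomial (x + y) := by
  have h := unitW_zpow_mul_unitV_zpow (θ := θ) y.1 x.2
  simp only [monomial, Units.val_mul, Prod.fst_add, Prod.snd_add, zpow_add] at h ⊢
  simp only [mul_assoc]
  rw [← mul_assoc _ (_ ^ y.1 : (Torus θ)ˣ).val, h]
  simp only [smul_mul_assoc, mul_smul_comm, mul_assoc]

theorem sigma_monomial (x : ℤ × ℤ) : sigma (monomial x : Torus θ) = monomial (-x) := by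
  have hV : Units.map (sigma (θ := θ) : Torus θ →* Torus θ) unitV = unitV⁻¹ :=
    Units.ext (by simp [sigma, unitV])
  have hW : Units.map (sigma (θ := θ) : Torus θ →* Torus θ) unitW = unitW⁻¹ :=
    Units.ext (by simp [sigma, unitW])
  have h : Units.map (sigma (θ := θ) : Torus θ →* Torus θ) (unitV ^ x.1 * unitW ^ x.2)
      = unitV ^ (-x.1) * unitW ^ (-x.2) := by
    rw [map_mul, map_zpow, map_zpow, hV, hW, inv_zpow', inv_zpow']
  exact congrArg Units.val h

theorem gen_mem_range_monomial (g : TorusGen) : (gen g : Torus θ) ∈ Set.range monomial := by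
  cases g
  · exact ⟨(1, 0), by simp [monomial, unitV]⟩
  · exact ⟨(-1, 0), by simp [monomial, unitV]⟩
  · exact ⟨(0, 1), by simp [monomial, unitW]⟩
  · exact ⟨(0, -1), by simp [monomial, unitW]⟩

theorem span_range_monomial : Submodule.span ℂ (Set.range (monomial (θ := θ))) = ⊤ := by
  refine eq_top_iff.2 fun a _ => ?_
  induction a using Torus.induction with
  | halg c =>
    rw [Algebra.algebraMap_eq_smul_one, ← monomial_zero]
    exact Submodule.smul_mem _ _ (Submodule.subset_span ⟨0, rfl⟩)
  | hgen g => exact Submodule.subset_span (gen_mem_range_monomial g)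
  | hmul a b ha hb =>
    have h := Submodule.mul_mem_mul (ha trivial) (hb trivial)
    rw [Submodule.span_mul_span] at h
    refine Submodule.span_le.2 ?_ h
    rintro _ ⟨_, ⟨x, rfl⟩, _, ⟨y, rfl⟩, rfl⟩
    simp only [monomial_mul]
    exact Submodule.smul_mem _ _ (Submodule.subset_span ⟨x + y, rfl⟩)
  | hadd a b ha hb => exact Submodule.add_mem _ (ha trivial) (hb trivial)

/-- The representation of the torus on functions on `ℤ`, with `V` acting as multiplication by
`n ↦ λⁿ` and `W` as the translation by `1`. It serves to show that the relations of the torus are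
consistent. -/
noncomputable def weylRep (θ : ℝ) : Torus θ →ₐ[ℂ] Module.End ℂ (ℤ → ℂ) :=
  lift (fun
    | .V => LinearMap.mulLeft ℂ fun n => torusParam θ ^ n
    | .Vs => LinearMap.mulLeft ℂ fun n => torusParam θ ^ (-n)
    | .W => LinearMap.funLeft ℂ ℂ (· - 1)
    | .Ws => LinearMap.funLeft ℂ ℂ (· + 1))
    (by ext; simp [zpow_ne_zero _ (torusParam_ne_zero θ)])
    (by ext; simp [zpow_ne_zero _ (torusParam_ne_zero θ)])
    (by ext; simp [LinearMap.funLeft_apply])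
    (by ext; simp [LinearMap.funLeft_apply])
    (by
      refine LinearMap.ext fun f => funext fun n => ?_
      have hn : torusParam θ ^ n = torusParam θ * torusParam θ ^ (n - 1) := by
        rw [← zpow_one_add₀ (torusParam_ne_zero θ), add_sub_cancel]
      simp [LinearMap.funLeft_apply, hn, mul_assoc])

instance : Nontrivial (Torus θ) := (weylRep θ).toRingHom.domain_nontrivial

theorem der_apply_monomial (p q : ℂ) (x : ℤ × ℤ) :
    der p q (monomial x : Torus θ) = (x.1 * p + x.2 * q) • monomial x := der_monomial p q x.1 x.2

theorem intCast_add_intCast_mul_injective {α : ℝ} (hα : Irrational α) :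
    Function.Injective fun x : ℤ × ℤ => (x.1 * 1 + x.2 * α : ℂ) := by
  rintro ⟨m, n⟩ ⟨m', n'⟩ h
  have hmn : ((n - n' : ℤ) * α : ℝ) = (m' - m : ℤ) := by
    have h : (m * 1 + n * α : ℝ) = m' * 1 + n' * α := by
      simp only at h
      exact_mod_cast h
    push_cast
    linear_combination h
  obtain rfl : n = n' := by
    by_contra hne
    exact (hα.intCast_mul (sub_ne_zero.2 hne)).ne_int _ hmn
  simpa using h

/- The monomials are eigenvectors of the derivation `V ↦ V`, `W ↦ √2 W`, for distinct
eigenvalues. -/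
theorem linearIndependent_monomial : LinearIndependent ℂ (monomial (θ := θ)) :=
  Module.End.eigenvectors_linearIndependent' (der (θ := θ) 1 (Real.sqrt 2 : ℂ)) _
    (intCast_add_intCast_mul_injective irrational_sqrt_two) monomial fun x =>
    Module.End.hasEigenvector_iff.2
      ⟨Module.End.mem_eigenspace_iff.2 (der_apply_monomial _ _ x), Units.ne_zero _⟩

/-- The basis `VᵐWⁿ` of the torus algebra. -/
noncomputable def monomialBasis (θ : ℝ) : Module.Basis (ℤ × ℤ) ℂ (Torus θ) :=
  Module.Basis.mk linearIndependent_monomial span_range_monomial.ge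

theorem monomialBasis_apply (x : ℤ × ℤ) : monomialBasis θ x = monomial x :=
  Module.Basis.mk_apply _ _ x

theorem monomialBasis_repr_der (p q : ℂ) (a : Torus θ) (x : ℤ × ℤ) :
    (monomialBasis θ).repr (der p q a) x = (x.1 * p + x.2 * q) * (monomialBasis θ).repr a x := by
  suffices h : (monomialBasis θ).coord x ∘ₗ der p q =
      (x.1 * p + x.2 * q) • (monomialBasis θ).coord x from LinearMap.congr_fun h a
  refine (monomialBasis θ).ext fun y => ?_
  have hy : der p q (monomialBasis θ y) = (y.1 * p + y.2 * q) • monomialBasis θ y := by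
    rw [monomialBasis_apply, der_apply_monomial]
  rcases eq_or_ne y x with rfl | hyx
  · simp [hy]
  · simp [hy, hyx]

theorem exists_eq_algebraMap_of_derV_eq_zero_of_derW_eq_zero {a : Torus θ} (hV : derV a = 0)
    (hW : derW a = 0) : ∃ c : ℂ, a = algebraMap ℂ (Torus θ) c := by
  have hsupp (x : ℤ × ℤ) (hx : x ≠ 0) : (monomialBasis θ).repr a x = 0 := by
    have hVx := monomialBasis_repr_der Complex.I 0 a x
    have hWx := monomialBasis_repr_der 0 Complex.I a x
    rw [← derV, hV] at hVx
    rw [← derW, hW] at hWx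
    by_contra ha
    exact hx (Prod.ext (by simpa [ha] using hVx) (by simpa [ha] using hWx))
  refine ⟨(monomialBasis θ).repr a 0, (monomialBasis θ).repr.injective ?_⟩
  rw [Algebra.algebraMap_eq_smul_one, ← monomial_zero, ← monomialBasis_apply, map_smul,
    Module.Basis.repr_self, Finsupp.smul_single_one]
  ext x
  rcases eq_or_ne x 0 with rfl | hx
  · simp
  · simp [hsupp x hx, hx]

end Torus

/-! ### Eigenvectors of `σ` -/

theorem left_mem_of_det_ne_zero {k M : Type*} [Field k] [AddCommGroup M] [Module k M]
    {S : Submodule k M} {s t : M} {a b c e : k} (h₁ : a • s + b • t ∈ S) (h₂ : c • s + e • t ∈ S)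
    (hdet : a * e - b * c ≠ 0) : s ∈ S := by
  have h : (a * e - b * c) • s ∈ S := by
    convert S.sub_mem (S.smul_mem e h₁) (S.smul_mem b h₂) using 1
    module
  exact (S.smul_mem_iff hdet).1 h

/-- Linear independence of two vectors of `ℤ²`, as the nonvanishing of their determinant. -/
def NotParallel (x y : ℤ × ℤ) : Prop := x.1 * y.2 ≠ x.2 * y.1

theorem notParallel_one_left {x : ℤ × ℤ} (hx : x ≠ 0) {t : ℤ} (ht : |x.2| < t) :
    NotParallel (1, t) x := by
  intro h
  rw [one_mul] at h
  have hx₂ : x.2 = 0 := Int.eq_zero_of_abs_lt_dvd ⟨x.1, h⟩ ht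
  have ht₀ : t ≠ 0 := ((abs_nonneg _).trans_lt ht).ne'
  have hx₁ : x.1 = 0 := by simpa [hx₂, ht₀] using h.symm
  exact hx (Prod.ext hx₁ hx₂)

theorem exists_notParallel {x y : ℤ × ℤ} (hx : x ≠ 0) (hy : y ≠ 0) :
    ∃ w, NotParallel w x ∧ NotParallel w y :=
  ⟨(1, |x.2| + |y.2| + 1),
    notParallel_one_left hx (by linarith [abs_nonneg y.2]),
    notParallel_one_left hy (by linarith [abs_nonneg x.2])⟩

namespace Torus

variable {θ : ℝ}

/-- The eigenvector `VᵐWⁿ + ε V⁻ᵐW⁻ⁿ` of `σ` with exponent `x = (m, n)` and eigenvalue `ε = ±1`. -/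
noncomputable def eigenMonomial (ε : ℤˣ) (x : ℤ × ℤ) : Torus θ := monomial x + ε • monomial (-x)

theorem eigenMonomial_neg (ε : ℤˣ) (x : ℤ × ℤ) :
    (eigenMonomial ε (-x) : Torus θ) = ε • eigenMonomial ε x := by
  rw [eigenMonomial, eigenMonomial, neg_neg, smul_add, smul_smul, Int.units_mul_self, one_smul,
    add_comm]

theorem eigenMonomial_neg_one_zero : (eigenMonomial (-1) 0 : Torus θ) = 0 := by
  simp [eigenMonomial]

theorem sigma_eigenMonomial (ε : ℤˣ) (x : ℤ × ℤ) :
    sigma (eigenMonomial ε x : Torus θ) = ε • eigenMonomial ε x := by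
  rw [← eigenMonomial_neg]
  simp [eigenMonomial, sigma_monomial, Units.smul_def]

theorem eigenMonomial_one_mem (x : ℤ × ℤ) : (eigenMonomial 1 x : Torus θ) ∈ Pillow θ :=
  mem_pillow.2 (by rw [sigma_eigenMonomial, one_smul])

theorem eigenMonomial_neg_one_mem (x : ℤ × ℤ) : (eigenMonomial (-1) x : Torus θ) ∈ Minus θ :=
  mem_minus.2 (by rw [sigma_eigenMonomial, Units.neg_smul, one_smul])

theorem der_eigenMonomial (p q : ℂ) (ε : ℤˣ) (x : ℤ × ℤ) :
    der p q (eigenMonomial ε x : Torus θ) = (x.1 * p + x.2 * q) • eigenMonomial (-ε) x := by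
  rcases Int.units_eq_one_or ε with rfl | rfl <;>
    simp [eigenMonomial, der_apply_monomial] <;> module

theorem eigenMonomial_mul (ε δ : ℤˣ) (x y : ℤ × ℤ) :
    (eigenMonomial ε x * eigenMonomial δ y : Torus θ) =
      torusParam θ ^ (-(x.2 * y.1)) • eigenMonomial (ε * δ) (x + y) +
        (δ * torusParam θ ^ (x.2 * y.1)) • eigenMonomial (ε * δ) (x - y) := by
  have hadd : -(x + y) = -x + -y := neg_add x y
  have hsub : -(x - y) = -x + y := by abel
  rcases Int.units_eq_one_or ε with rfl | rfl <;> rcases Int.units_eq_one_or δ with rfl | rfl <;>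
    simp [eigenMonomial, add_mul, mul_add, sub_mul, mul_sub, monomial_mul, hadd, hsub,
      ← sub_eq_add_neg, -neg_add_rev, -neg_sub] <;> module

theorem eigenMonomial_mul_swap (ε δ : ℤˣ) (x y : ℤ × ℤ) :
    (eigenMonomial δ y * eigenMonomial ε x : Torus θ) =
      torusParam θ ^ (-(y.2 * x.1)) • eigenMonomial (ε * δ) (x + y) +
        (δ * torusParam θ ^ (y.2 * x.1)) • eigenMonomial (ε * δ) (x - y) := by
  have hε : (ε : ℂ) * (ε * δ : ℤˣ) = δ := by
    rcases Int.units_eq_one_or ε with rfl | rfl <;> simp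
  rw [eigenMonomial_mul, mul_comm δ, add_comm y, ← neg_sub x y, eigenMonomial_neg, Units.smul_def,
    ← Int.cast_smul_eq_zsmul ℂ, smul_smul, mul_right_comm, hε]

theorem mem_of_forall_eigenMonomial_mem {S : Submodule ℂ (Torus θ)} {ε : ℤˣ}
    (hS : ∀ x, eigenMonomial ε x ∈ S) {a : Torus θ} (ha : sigma a = ε • a) : a ∈ S := by
  have h (b : Torus θ) : b + ε • sigma b ∈ S := by
    have hb : b ∈ Submodule.span ℂ (Set.range (monomial (θ := θ))) :=
      span_range_monomial ▸ Submodule.mem_top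
    induction hb using Submodule.span_induction with
    | mem b hb =>
      obtain ⟨x, rfl⟩ := hb
      rw [sigma_monomial]
      exact hS x
    | zero => simp
    | add b c _ _ hb hc =>
      rw [map_add, smul_add, add_add_add_comm]
      exact S.add_mem hb hc
    | smul c b _ hb =>
      rw [map_smul, smul_comm, ← smul_add]
      exact S.smul_mem c hb
  have h2 : (2 : ℂ) • a ∈ S := by
    have := h a
    rwa [ha, smul_smul, Int.units_mul_self, one_smul, ← two_smul ℂ a] at this
  exact (S.smul_mem_iff two_ne_zero).1 h2

/- Multiplying in the two orders yields two combinations of `eigenMonomial (ε * δ) (x ± y)`, and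
their determinant vanishes only if `λ^(2D) = 1` for `D = x.1 * y.2 - x.2 * y.1`. -/
theorem eigenMonomial_add_mem (hθ : Irrational θ) {S : Submodule ℂ (Torus θ)} {ε δ : ℤˣ}
    {x y : ℤ × ℤ} (hxy : NotParallel x y) (hl : eigenMonomial ε x * eigenMonomial δ y ∈ S)
    (hr : eigenMonomial δ y * eigenMonomial ε x ∈ S) : eigenMonomial (ε * δ) (x + y) ∈ S := by
  rw [eigenMonomial_mul] at hl
  rw [eigenMonomial_mul_swap] at hr
  refine left_mem_of_det_ne_zero hl hr ?_
  have hδ : (δ : ℂ) ≠ 0 := by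
    rcases Int.units_eq_one_or δ with rfl | rfl <;> simp
  have hdet : -(x.2 * y.1) + y.2 * x.1 ≠ x.2 * y.1 + -(y.2 * x.1) := fun h => hxy (by linarith)
  have hpow := (torusParam_zpow_injective hθ).ne hdet
  simp only [zpow_add₀ (torusParam_ne_zero θ)] at hpow
  contrapose! hpow
  apply mul_left_cancel₀ hδ
  linear_combination hpow

theorem pillow_mul_minus_le : (Pillow θ).toSubmodule * Minus θ ≤ Minus θ :=
  Submodule.mul_le.2 fun a ha b hb => by
    rw [Subalgebra.mem_toSubmodule, mem_pillow] at ha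
    rw [mem_minus] at hb ⊢
    rw [map_mul, ha, hb, mul_neg]

theorem minus_mul_pillow_le : Minus θ * (Pillow θ).toSubmodule ≤ Minus θ :=
  Submodule.mul_le.2 fun a ha b hb => by
    rw [Subalgebra.mem_toSubmodule, mem_pillow] at hb
    rw [mem_minus] at ha ⊢
    rw [map_mul, ha, hb, neg_mul]

theorem minus_mul_minus_le : Minus θ * Minus θ ≤ (Pillow θ).toSubmodule :=
  Submodule.mul_le.2 fun a ha b hb => by
    rw [mem_minus] at ha hb
    rw [Subalgebra.mem_toSubmodule, mem_pillow, map_mul, ha, hb, neg_mul_neg]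

theorem minus_le_of_eigenMonomial_mem (hθ : Irrational θ) {S : Submodule ℂ (Torus θ)}
    (hl : (Pillow θ).toSubmodule * S ≤ S) (hr : S * (Pillow θ).toSubmodule ≤ S) {e : ℤ × ℤ}
    (he : e ≠ 0) (h : eigenMonomial (-1) e ∈ S) : Minus θ ≤ S := by
  have hstep {x z : ℤ × ℤ} (hxz : NotParallel x z) (hx : eigenMonomial (-1) x ∈ S) :
      eigenMonomial (-1) z ∈ S := by
    have hadd : NotParallel x (z - x) := by
      simp only [NotParallel, Prod.fst_sub, Prod.snd_sub] at hxz ⊢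
      contrapose! hxz
      linear_combination hxz
    simpa using eigenMonomial_add_mem hθ hadd
      (hr (Submodule.mul_mem_mul hx (eigenMonomial_one_mem _)))
      (hl (Submodule.mul_mem_mul (eigenMonomial_one_mem _) hx))
  refine fun a ha => mem_of_forall_eigenMonomial_mem (ε := -1) (fun z => ?_)
    (by simpa using mem_minus.1 ha)
  rcases eq_or_ne z 0 with rfl | hz
  · rw [eigenMonomial_neg_one_zero]
    exact S.zero_mem
  obtain ⟨w, hwe, hwz⟩ := exists_notParallel he hz
  exact hstep hwz (hstep (fun h' => hwe (by linear_combination -h')) h)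

theorem one_mem_minus_mul_minus (hθ : Irrational θ) : (1 : Torus θ) ∈ Minus θ * Minus θ := by
  have hmul (x y : ℤ × ℤ) : (eigenMonomial (-1) x * eigenMonomial (-1) y : Torus θ) ∈
      Minus θ * Minus θ :=
    Submodule.mul_mem_mul (eigenMonomial_neg_one_mem x) (eigenMonomial_neg_one_mem y)
  have h₂ : (eigenMonomial (-1 * -1) ((1, 1) + (1, -1)) : Torus θ) ∈ Minus θ * Minus θ :=
    eigenMonomial_add_mem hθ (by simp [NotParallel]) (hmul _ _) (hmul _ _)
  have h : (2 : ℂ) • (1 : Torus θ) ∈ Minus θ * Minus θ := by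
    convert Submodule.sub_mem _ h₂ (hmul (1, 0) (1, 0)) using 1
    rw [eigenMonomial_mul]
    simp [eigenMonomial, monomial_zero, two_smul]
  exact (Submodule.smul_mem_iff _ two_ne_zero).1 h

theorem pillow_le_minus_mul_minus (hθ : Irrational θ) :
    (Pillow θ).toSubmodule ≤ Minus θ * Minus θ :=
  calc (Pillow θ).toSubmodule = (Pillow θ).toSubmodule * 1 := (mul_one _).symm
    _ ≤ (Pillow θ).toSubmodule * (Minus θ * Minus θ) := by
      gcongr
      exact Submodule.one_le.2 (one_mem_minus_mul_minus hθ)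
    _ = (Pillow θ).toSubmodule * Minus θ * Minus θ := (mul_assoc _ _ _).symm
    _ ≤ Minus θ * Minus θ := by grw [pillow_mul_minus_le]

end Torus

/-! ### Growth -/

theorem NotParallel.induction_on {P : ℤ × ℤ → Prop} {z : ℤ × ℤ} (hz : z ≠ 0)
    (one_zero : P (1, 0)) (zero_one : P (0, 1)) (neg : ∀ x, P x → P (-x))
    (add : ∀ x y, NotParallel x y → P x → P y → P (x + y)) : P z := by
  have row_one (m : ℤ) : P (m, 1) := by
    induction m with
    | zero => exact zero_one
    | succ m ih => simpa using add _ _ (by simp [NotParallel]) ih one_zero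
    | pred m ih => simpa [sub_eq_add_neg] using add _ _ (by simp [NotParallel]) ih (neg _ one_zero)
  have row_succ (n : ℕ) (m : ℤ) : P (m, n + 1) := by
    induction n generalizing m with
    | zero => simpa using row_one m
    | succ n ih =>
      obtain ⟨s, hs⟩ : ∃ s : ℤ, NotParallel (s, (n : ℤ) + 1) (m - s, 1) := by
        rcases eq_or_ne m 0 with rfl | hm
        · exact ⟨1, by simp only [NotParallel]; omega⟩
        · exact ⟨0, by simpa [NotParallel] using ⟨by omega, hm⟩⟩
      simpa using add _ _ hs (ih s) (row_one (m - s))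
  obtain ⟨m, n⟩ := z
  rcases lt_trichotomy n 0 with hn | rfl | hn
  · obtain ⟨k, hk⟩ := Int.eq_succ_of_zero_lt (neg_pos.2 hn)
    simpa [← hk] using neg _ (row_succ k (-m))
  · have hm : m ≠ 0 := fun h => hz (by rw [h]; rfl)
    simpa using add _ _ (by simpa [NotParallel] using hm) (row_one m) (neg _ zero_one)
  · obtain ⟨k, rfl⟩ := Int.eq_succ_of_zero_lt hn
    exact row_succ k m

section Growth

variable {k A : Type u} [Field k] [Ring A] [Algebra k A]

theorem exists_mem_one_sup_pow {V : Submodule k A} {a : A}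
    (ha : a ∈ Algebra.adjoin k (V : Set A)) : ∃ N, a ∈ (1 ⊔ V) ^ N := by
  have hmono {m n : ℕ} (h : m ≤ n) : (1 ⊔ V) ^ m ≤ (1 ⊔ V) ^ n := pow_le_pow_right' le_sup_left h
  induction ha using Algebra.adjoin_induction with
  | mem a ha => exact ⟨1, by rw [pow_one]; exact Submodule.mem_sup_right ha⟩
  | algebraMap c => exact ⟨0, by rw [pow_zero]; exact Submodule.algebraMap_mem c⟩
  | add a b _ _ ha hb =>
    obtain ⟨m, hm⟩ := ha
    obtain ⟨n, hn⟩ := hb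
    exact ⟨max m n, add_mem (hmono (le_max_left m n) hm) (hmono (le_max_right m n) hn)⟩
  | mul a b _ _ ha hb =>
    obtain ⟨m, hm⟩ := ha
    obtain ⟨n, hn⟩ := hb
    exact ⟨m + n, by rw [pow_add]; exact Submodule.mul_mem_mul hm hn⟩

theorem growthExponent_map {B : Type u} [Ring B] [Algebra k B] {f : A →ₐ[k] B}
    (hf : Function.Injective f) (V : Submodule k A) :
    growthExponent k (V.map f.toLinearMap) = growthExponent k V := by
  have hrank (n : ℕ) : Module.finrank k ((1 ⊔ V.map f.toLinearMap) ^ n : Submodule k B) =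
      Module.finrank k ((1 ⊔ V) ^ n : Submodule k A) := by
    rw [← Submodule.map_one f, ← Submodule.map_sup, ← Submodule.map_pow]
    exact (Submodule.equivMapOfInjective _ hf _).finrank_eq.symm
  simp only [growthExponent, hrank]

theorem growthExponent_le_of_finrank_le {V : Submodule k A} {C d : ℕ}
    (h : ∀ n : ℕ, 1 ≤ n → Module.finrank k ((1 ⊔ V) ^ n : Submodule k A) ≤ C * n ^ d) :
    growthExponent k V ≤ ((d : ℝ) : EReal) := by
  refine EReal.le_of_forall_lt_iff_le.1 fun ν hν => sInf_le ⟨ν, ?_, rfl⟩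
  have hν' : 0 < ν - d := sub_pos.2 (by exact_mod_cast hν)
  have htop : Tendsto (fun n : ℕ => (n : ℝ) ^ (ν - d)) atTop atTop :=
    (tendsto_rpow_atTop hν').comp tendsto_natCast_atTop_atTop
  filter_upwards [htop.eventually_ge_atTop (C : ℝ), eventually_ge_atTop 1] with n hn hn1
  have hpos : (0 : ℝ) < n := by exact_mod_cast hn1
  calc (Module.finrank k ((1 ⊔ V) ^ n : Submodule k A) : ℝ) ≤ C * (n : ℝ) ^ d := by
        exact_mod_cast h n hn1
    _ ≤ (n : ℝ) ^ (ν - d) * (n : ℝ) ^ d := by gcongr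
    _ = (n : ℝ) ^ ν := by rw [← Real.rpow_natCast, ← Real.rpow_add hpos, sub_add_cancel]

theorem le_growthExponent_of_le_finrank {V : Submodule k A} {C d : ℕ} (hC : 0 < C)
    (h : ∀ n : ℕ, n ^ d ≤ Module.finrank k ((1 ⊔ V) ^ (C * n) : Submodule k A)) :
    ((d : ℝ) : EReal) ≤ growthExponent k V := by
  refine le_sInf ?_
  rintro _ ⟨ν, hν, rfl⟩
  rw [EReal.coe_le_coe_iff]
  by_contra! hlt
  have htop : Tendsto (fun n : ℕ => (n : ℝ) ^ (d - ν)) atTop atTop :=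
    (tendsto_rpow_atTop (sub_pos.2 hlt)).comp tendsto_natCast_atTop_atTop
  obtain ⟨n, hn, hn1, hn2⟩ := (((tendsto_id.const_mul_atTop' hC).eventually hν).and
    ((eventually_ge_atTop 1).and (htop.eventually_gt_atTop ((C : ℝ) ^ ν)))).exists
  have hpos : (0 : ℝ) < n := by exact_mod_cast hn1
  have hlt : (n : ℝ) ^ d < (n : ℝ) ^ d :=
    calc (n : ℝ) ^ d ≤ Module.finrank k ((1 ⊔ V) ^ (C * n) : Submodule k A) := by
          exact_mod_cast h n
      _ ≤ ((C * n : ℕ) : ℝ) ^ ν := hn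
      _ = (C : ℝ) ^ ν * (n : ℝ) ^ ν := by
          rw [Nat.cast_mul, Real.mul_rpow (by positivity) (by positivity)]
      _ < (n : ℝ) ^ (d - ν) * (n : ℝ) ^ ν := by gcongr
      _ = (n : ℝ) ^ d := by rw [← Real.rpow_add hpos, sub_add_cancel, Real.rpow_natCast]
  exact lt_irrefl _ hlt

end Growth

namespace Torus

variable {θ : ℝ}

theorem adjoin_eigenMonomial_eq_pillow (hθ : Irrational θ) :
    Algebra.adjoin ℂ {eigenMonomial 1 (1, 0), eigenMonomial 1 (0, 1)} = Pillow θ := by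
  apply le_antisymm
  · rw [Algebra.adjoin_le_iff, Set.pair_subset_iff]
    exact ⟨eigenMonomial_one_mem _, eigenMonomial_one_mem _⟩
  set S : Subalgebra ℂ (Torus θ) :=
    Algebra.adjoin ℂ {eigenMonomial 1 (1, 0), eigenMonomial 1 (0, 1)}
  suffices h : ∀ x, eigenMonomial 1 x ∈ S from fun a ha =>
    mem_of_forall_eigenMonomial_mem (S := S.toSubmodule) h (ha.trans (one_smul _ a).symm)
  intro x
  rcases eq_or_ne x 0 with rfl | hx
  · simpa [eigenMonomial, monomial_zero] using S.add_mem S.one_mem S.one_mem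
  refine NotParallel.induction_on (P := (eigenMonomial 1 · ∈ S)) hx
    (Algebra.subset_adjoin (by simp)) (Algebra.subset_adjoin (by simp)) ?neg ?add
  case neg => exact fun x hx => by rwa [eigenMonomial_neg, one_smul]
  case add =>
    intro x y hxy hx hy
    have h := eigenMonomial_add_mem (S := S.toSubmodule) hθ hxy (S.mul_mem hx hy) (S.mul_mem hy hx)
    rwa [mul_one] at h

theorem eigenMonomial_mem_pow (hθ : Irrational θ) {X : Submodule ℂ (Torus θ)}
    (hV : eigenMonomial 1 (1, 0) ∈ X) (hW : eigenMonomial 1 (0, 1) ∈ X) (m n : ℕ) :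
    (eigenMonomial 1 (m + 1, n + 1) : Torus θ) ∈ X ^ ((m + 1) + (n + 1)) := by
  have hadd {x y : ℤ × ℤ} {l : ℕ} (hxy : NotParallel x y) (hx : eigenMonomial 1 x ∈ X ^ l)
      (hy : eigenMonomial 1 y ∈ X) : eigenMonomial 1 (x + y) ∈ X ^ (l + 1) := by
    have h := eigenMonomial_add_mem (S := X ^ (l + 1)) hθ hxy
      (by rw [pow_succ]; exact Submodule.mul_mem_mul hx hy)
      (by rw [pow_succ']; exact Submodule.mul_mem_mul hy hx)
    rwa [mul_one] at h
  have row_one (m : ℕ) : (eigenMonomial 1 (m, 1) : Torus θ) ∈ X ^ (m + 1) := by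
    induction m with
    | zero => simpa using hW
    | succ m ih => simpa using hadd (by simp [NotParallel]) ih hV
  induction n with
  | zero => simpa using row_one (m + 1)
  | succ n ih =>
    have hne : NotParallel (m + 1, n + 1) (0, 1) := by simpa [NotParallel] using by omega
    simpa [← add_assoc] using hadd hne ih hW

theorem linearIndependent_eigenMonomial (ε : ℤˣ) :
    LinearIndependent ℂ fun x : {x : ℤ × ℤ // 0 < x.1} => (eigenMonomial ε x : Torus θ) := by
  let proj : Torus θ →ₗ[ℂ] Torus θ :=
    (monomialBasis θ).constr ℂ fun x => if 0 < x.1 then monomial x else 0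
  have hproj (x : ℤ × ℤ) : proj (monomial x) = if 0 < x.1 then monomial x else 0 := by
    rw [← monomialBasis_apply, Module.Basis.constr_basis, monomialBasis_apply]
  refine LinearIndependent.of_comp proj ?_
  convert linearIndependent_monomial.comp _ Subtype.val_injective using 1
  ext1 ⟨x, hx⟩
  simp [eigenMonomial, hproj, hx, hx.le]

/-- The span of the monomials `VᵐWⁿ` with `|m|, |n| ≤ K`. -/
noncomputable def box (θ : ℝ) (K : ℕ) : Submodule ℂ (Torus θ) :=
  Submodule.span ℂ (monomial '' Set.Icc (-K, -K) (K, K))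

theorem box_mono : Monotone (box θ) := fun K L h => by
  have h : (K : ℤ) ≤ L := by exact_mod_cast h
  exact Submodule.span_mono
    (Set.image_mono (Set.Icc_subset_Icc (by simpa using h) (by simpa using h)))

theorem box_mul_box_le (K L : ℕ) : box θ K * box θ L ≤ box θ (K + L) := by
  rw [box, box, Submodule.span_mul_span, Submodule.span_le]
  rintro _ ⟨_, ⟨x, hx, rfl⟩, _, ⟨y, hy, rfl⟩, rfl⟩
  simp only [monomial_mul]
  refine Submodule.smul_mem _ _ (Submodule.subset_span ⟨x + y, ?_, rfl⟩)
  simp only [Set.mem_Icc, Prod.le_def, Prod.fst_add, Prod.snd_add] at hx hy ⊢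
  omega

theorem one_le_box (K : ℕ) : 1 ≤ box θ K :=
  Submodule.one_le.2 (Submodule.subset_span ⟨0, by simp [Prod.le_def], monomial_zero⟩)

theorem box_pow_le (K n : ℕ) : box θ K ^ n ≤ box θ (n * K) := by
  induction n with
  | zero => exact one_le_box _
  | succ n ih =>
    rw [pow_succ, Nat.succ_mul]
    exact (mul_le_mul' ih le_rfl).trans (box_mul_box_le _ _)

instance finiteDimensional_box (K : ℕ) : FiniteDimensional ℂ (box θ K) :=
  FiniteDimensional.span_of_finite ℂ ((Set.finite_Icc _ _).image _)

theorem finrank_box_le (K : ℕ) : Module.finrank ℂ (box θ K) ≤ (2 * K + 1) ^ 2 := by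
  classical
  have hIcc : (Finset.Icc (-K) K : Finset ℤ).card = 2 * K + 1 := by
    rw [Int.card_Icc]
    omega
  rw [box, ← Finset.coe_Icc, ← Finset.coe_image]
  refine (finrank_span_finset_le_card _).trans (Finset.card_image_le.trans ?_)
  rw [Finset.card_Icc_prod, hIcc, sq]

theorem iSup_box : ⨆ K, box θ K = ⊤ := by
  rw [eq_top_iff, ← span_range_monomial, Submodule.span_le]
  rintro _ ⟨x, rfl⟩
  refine Submodule.mem_iSup_of_mem (x.1.natAbs + x.2.natAbs) (Submodule.subset_span ⟨x, ?_, rfl⟩)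
  simp only [Set.mem_Icc, Prod.le_def]
  omega

theorem exists_le_box {V : Submodule ℂ (Torus θ)} (hV : V.FG) : ∃ K, V ≤ box θ K := by
  obtain ⟨s, hs⟩ := CompleteLattice.IsCompactElement.exists_finset_of_le_iSup _
    ((Submodule.fg_iff_compact V).1 hV) (box θ) (le_top.trans_eq iSup_box.symm)
  exact ⟨s.sup id, hs.trans (iSup₂_le fun _ hi => box_mono (Finset.le_sup (f := id) hi))⟩

theorem growthExponent_le_two {V : Submodule ℂ (Torus θ)} (hV : V.FG) :
    growthExponent ℂ V ≤ ((2 : ℕ) : ℝ) := by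
  obtain ⟨K, hK⟩ := exists_le_box hV
  refine growthExponent_le_of_finrank_le (C := (2 * K + 1) ^ 2) fun n hn => ?_
  have hpow : (1 ⊔ V) ^ n ≤ box θ (n * K) :=
    (pow_le_pow_left' (sup_le (one_le_box K) hK) n).trans (box_pow_le K n)
  calc Module.finrank ℂ ((1 ⊔ V) ^ n : Submodule ℂ (Torus θ))
      ≤ Module.finrank ℂ (box θ (n * K)) := Submodule.finrank_mono hpow
    _ ≤ (2 * (n * K) + 1) ^ 2 := finrank_box_le _
    _ ≤ ((2 * K + 1) * n) ^ 2 := by gcongr; nlinarith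
    _ = (2 * K + 1) ^ 2 * n ^ 2 := mul_pow _ _ _

theorem sq_le_finrank_pow (hθ : Irrational θ) {X : Submodule ℂ (Torus θ)} (hX : X.FG)
    (h1 : 1 ≤ X) (hV : eigenMonomial 1 (1, 0) ∈ X) (hW : eigenMonomial 1 (0, 1) ∈ X) (m : ℕ) :
    m ^ 2 ≤ Module.finrank ℂ (X ^ (2 * m) : Submodule ℂ (Torus θ)) := by
  have hinj : Function.Injective fun x : Fin m × Fin m =>
      (⟨((x.1 : ℤ) + 1, (x.2 : ℤ) + 1), by dsimp only; omega⟩ : {x : ℤ × ℤ // 0 < x.1}) := by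
    intro x y h
    simpa [Prod.ext_iff, Fin.ext_iff] using h
  have hcard := finrank_span_eq_card
    ((linearIndependent_eigenMonomial (θ := θ) 1).comp _ hinj)
  rw [Fintype.card_prod, Fintype.card_fin, ← sq] at hcard
  have : FiniteDimensional ℂ (X ^ (2 * m) : Submodule ℂ (Torus θ)) :=
    Module.Finite.iff_fg.2 (hX.pow _)
  rw [← hcard]
  refine Submodule.finrank_mono (Submodule.span_le.2 ?_)
  rintro _ ⟨x, rfl⟩
  exact pow_le_pow_right' h1 (by omega) (eigenMonomial_mem_pow hθ hV hW x.1 x.2)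

theorem two_le_growthExponent (hθ : Irrational θ) {V : Submodule ℂ (Torus θ)} (hV : V.FG)
    (hgen : Pillow θ ≤ Algebra.adjoin ℂ (V : Set (Torus θ))) :
    ((2 : ℕ) : ℝ) ≤ growthExponent ℂ V := by
  obtain ⟨M, hM⟩ := exists_mem_one_sup_pow (hgen (eigenMonomial_one_mem (1, 0)))
  obtain ⟨N, hN⟩ := exists_mem_one_sup_pow (hgen (eigenMonomial_one_mem (0, 1)))
  have hfg : (1 ⊔ V).FG := by
    rw [Submodule.one_eq_span]
    exact (Submodule.fg_span_singleton 1).sup hV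
  have h1 : 1 ≤ 1 ⊔ V := le_sup_left
  refine le_growthExponent_of_le_finrank (C := 2 * (M + N + 1)) (by omega) fun m => ?_
  rw [mul_comm 2, mul_assoc, pow_mul]
  exact sq_le_finrank_pow hθ (hfg.pow _) (one_le_pow_of_one_le' h1 _)
    (pow_le_pow_right' h1 (by omega) hM) (pow_le_pow_right' h1 (by omega) hN) m

end Torus

theorem pillow_finiteType {θ : ℝ} (hθ : Irrational θ) : Algebra.FiniteType ℂ (Pillow θ) := by
  rw [← Subalgebra.fg_iff_finiteType, Subalgebra.fg_def]
  exact ⟨_, Set.toFinite _, Torus.adjoin_eigenMonomial_eq_pillow hθ⟩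

theorem pillow_isAffineOfGKDim {θ : ℝ} (hθ : Irrational θ) :
    IsAffineOfGKDim ℂ (Pillow θ) 2 := by
  refine ⟨pillow_finiteType hθ, fun V hfin hgen => ?_⟩
  have hfg : (V.map (Pillow θ).val.toLinearMap).FG := (Module.Finite.iff_fg.1 hfin).map _
  have hgen' : Pillow θ ≤ Algebra.adjoin ℂ (V.map (Pillow θ).val.toLinearMap : Set (Torus θ)) := by
    rw [Submodule.map_coe, AlgHom.coe_toLinearMap, ← AlgHom.map_adjoin, hgen, Algebra.map_top,
      Subalgebra.range_val]
  rw [← growthExponent_map (f := (Pillow θ).val) Subtype.val_injective]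
  exact le_antisymm (Torus.growthExponent_le_two hfg) (Torus.two_le_growthExponent hθ hfg hgen')

/-! ### Calculi -/

namespace DGAlgebraOver

section Calculus

variable {k A : Type u} [Field k] [Ring A] [Algebra k A] (Ω : DGAlgebraOver k A)

theorem one_le_grade_zero : 1 ≤ Ω.grade 0 :=
  Submodule.one_le.2 SetLike.GradedOne.one_mem

theorem grade_mul_grade_le (m n : ℕ) : Ω.grade m * Ω.grade n ≤ Ω.grade (m + n) :=
  Submodule.mul_le.2 fun _ hx _ hy => SetLike.mul_mem_graded hx hy

theorem map_d_mul_grade_zero_le :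
    (Ω.grade 0).map Ω.d * Ω.grade 0 ≤ Ω.grade 0 * (Ω.grade 0).map Ω.d := by
  rw [Submodule.mul_le]
  rintro _ ⟨a, ha, rfl⟩ b hb
  have h : Ω.d a * b = 1 * Ω.d (a * b) - a * Ω.d b := by
    rw [Ω.leibniz b ha, pow_zero, one_mul, one_mul, add_sub_cancel_right]
  rw [h]
  exact Submodule.sub_mem _
    (Submodule.mul_mem_mul (Submodule.one_le.1 Ω.one_le_grade_zero)
      (Submodule.mem_map_of_mem (Ω.grade_mul_grade_le 0 0 (Submodule.mul_mem_mul ha hb))))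
    (Submodule.mul_mem_mul ha (Submodule.mem_map_of_mem hb))

theorem map_d_pow_mul_grade_zero_le (n : ℕ) :
    (Ω.grade 0).map Ω.d ^ n * Ω.grade 0 ≤ Ω.grade 0 * (Ω.grade 0).map Ω.d ^ n := by
  induction n with
  | zero => simp
  | succ n ih =>
    calc (Ω.grade 0).map Ω.d ^ (n + 1) * Ω.grade 0
        = (Ω.grade 0).map Ω.d ^ n * ((Ω.grade 0).map Ω.d * Ω.grade 0) := by
          rw [pow_succ, mul_assoc]
      _ ≤ (Ω.grade 0).map Ω.d ^ n * (Ω.grade 0 * (Ω.grade 0).map Ω.d) := by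
          grw [Ω.map_d_mul_grade_zero_le]
      _ = (Ω.grade 0).map Ω.d ^ n * Ω.grade 0 * (Ω.grade 0).map Ω.d := (mul_assoc _ _ _).symm
      _ ≤ Ω.grade 0 * (Ω.grade 0).map Ω.d ^ n * (Ω.grade 0).map Ω.d := by gcongr
      _ = Ω.grade 0 * (Ω.grade 0).map Ω.d ^ (n + 1) := by rw [pow_succ, mul_assoc]

theorem grade_zero_mul_map_d_pow_le (n : ℕ) :
    Ω.grade 0 * (Ω.grade 0).map Ω.d ^ n ≤ Ω.grade n := by
  have hd : (Ω.grade 0).map Ω.d ≤ Ω.grade 1 := Submodule.map_le_iff_le_comap.2 fun _ => Ω.d_mem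
  induction n with
  | zero => simp
  | succ n ih =>
    rw [pow_succ, ← mul_assoc]
    exact (mul_le_mul' ih hd).trans (Ω.grade_mul_grade_le n 1)

theorem isCalculus_of_grade_succ_le (h₁ : Ω.grade 1 ≤ Ω.grade 0 * (Ω.grade 0).map Ω.d)
    (hsucc : ∀ n, Ω.grade (n + 1) ≤ Ω.grade n * Ω.grade 1) : Ω.IsCalculus := by
  intro n
  refine le_antisymm ?_ (Ω.grade_zero_mul_map_d_pow_le n)
  set D := (Ω.grade 0).map Ω.d
  induction n with
  | zero => simp
  | succ n ih =>
    calc Ω.grade (n + 1) ≤ Ω.grade n * Ω.grade 1 := hsucc n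
      _ ≤ Ω.grade 0 * D ^ n * (Ω.grade 0 * D) := by gcongr
      _ = Ω.grade 0 * (D ^ n * Ω.grade 0) * D := by simp only [mul_assoc]
      _ ≤ Ω.grade 0 * (Ω.grade 0 * D ^ n) * D := by grw [Ω.map_d_pow_mul_grade_zero_le n]
      _ = Ω.grade 0 * Ω.grade 0 * D ^ (n + 1) := by simp only [mul_assoc, pow_succ]
      _ ≤ Ω.grade 0 * D ^ (n + 1) := by grw [Ω.grade_mul_grade_le 0 0]

end Calculus

end DGAlgebraOver

/-! ### Integrability -/

namespace DGAlgebraOver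

variable {k A : Type u} [Field k] [Ring A] [Algebra k A] {Ω : DGAlgebraOver k A} {m n : ℕ}

section Coercions

@[simp]
theorem coe_lmul (a : A) (ω : Ω.grade n) : (lmul a ω : Ω.Form) = Ω.ι a * ω := rfl

@[simp]
theorem coe_rmul (ω : Ω.grade n) (a : A) : (rmul ω a : Ω.Form) = ω * Ω.ι a := rfl

@[simp]
theorem coe_wedge (ω : Ω.grade m) (η : Ω.grade n) : (wedge ω η : Ω.Form) = ω * η := rfl

@[simp]
theorem coe_dGrade (ω : Ω.grade n) : (Ω.dGrade n ω : Ω.Form) = Ω.d ω := rfl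

@[simp]
theorem coe_dZero (a : A) : (Ω.dZero a : Ω.Form) = Ω.d (Ω.ι a) := rfl

@[simp]
theorem leftAct_apply (a : A) (φ : Ω.IntegralForm n) (ω : Ω.grade n) :
    (leftAct a φ).1 ω = a * φ.1 ω := rfl

@[simp]
theorem rightAct_apply (φ : Ω.IntegralForm n) (a : A) (ω : Ω.grade n) :
    (rightAct φ a).1 ω = φ.1 (lmul a ω) := rfl

@[simp]
theorem formAct_apply (φ : Ω.IntegralForm (m + n)) (ω : Ω.grade m) (η : Ω.grade n) :
    (formAct φ ω).1 η = φ.1 (wedge ω η) := rfl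

theorem Divergence.ext_apply (D : Ω.Divergence) (φ : Ω.IntegralForm (n + 1)) (ω : Ω.grade n) :
    (D.ext n φ).1 ω = D.toLin (formAct φ ω) + (-1 : k) ^ (n + 1) • φ.1 (Ω.dGrade n ω) := by
  rw [Algebra.smul_def, map_pow, map_neg, map_one]
  rfl

@[ext]
theorem IntegralForm.ext {φ ψ : Ω.IntegralForm n} (h : ∀ ω, φ.1 ω = ψ.1 ω) : φ = ψ :=
  Subtype.ext (LinearMap.ext h)

end Coercions

theorem leibniz_smul {x : Ω.Form} (hx : x ∈ Ω.grade n) (y : Ω.Form) :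
    Ω.d (x * y) = Ω.d x * y + (-1 : k) ^ n • (x * Ω.d y) := by
  rw [Ω.leibniz y hx, Algebra.smul_def, map_pow, map_neg, map_one]

variable (Ω) in
/-- A linear map `∫ : Ω → A` which is right `A`-linear and left `A`-linear up to an automorphism
of `A`. Restricted to the top degree it plays the role of an inverse to a volume form. -/
structure TwistedVolume where
  toLin : Ω.Form →ₗ[k] A
  twist : A ≃ₐ[k] A
  map_mul_ι : ∀ x a, toLin (x * Ω.ι a) = toLin x * a
  map_ι_mul : ∀ a x, toLin (Ω.ι a * x) = twist a * toLin x

namespace TwistedVolume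

variable (vol : Ω.TwistedVolume)

/-- The map `ω ↦ (η ↦ ± vol(ω ∧ η))` from `Ωⁱ` to `ℐₗ`. The sign `(-1)ⁿⁱ`, where the calculus has
dimension `n + 1`, makes these maps intertwine `d` with a divergence. -/
def pairing (n i l : ℕ) : Ω.grade i →ₗ[k] Ω.IntegralForm l where
  toFun ω := ⟨(-1 : k) ^ (n * i) • vol.toLin ∘ₗ LinearMap.mulLeft k ω ∘ₗ (Ω.grade l).subtype,
    fun η a => by simp [← mul_assoc, vol.map_mul_ι]⟩
  map_add' ω ω' := by ext; simp [add_mul]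
  map_smul' c ω := by ext; simp [smul_comm c]

@[simp]
theorem pairing_apply (n : ℕ) {i l : ℕ} (ω : Ω.grade i) (η : Ω.grade l) :
    (vol.pairing n i l ω).1 η = (-1 : k) ^ (n * i) • vol.toLin (ω * η) := rfl

theorem pairing_rmul (n : ℕ) {i l : ℕ} (ω : Ω.grade i) (b : A) :
    vol.pairing n i l (rmul ω b) = rightAct (vol.pairing n i l ω) b := by
  ext η
  simp [mul_assoc]

theorem pairing_lmul (n : ℕ) {i l : ℕ} (a : A) (ω : Ω.grade i) :
    vol.pairing n i l (lmul a ω) = leftAct (vol.twist a) (vol.pairing n i l ω) := by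
  ext η
  simp [mul_assoc, vol.map_ι_mul]

theorem formAct_pairing (n : ℕ) {i l m : ℕ} (ω : Ω.grade i) (η : Ω.grade l) :
    formAct (vol.pairing n i (l + m) ω) η =
      (-1 : k) ^ (n * l) • vol.pairing n (i + l) m (wedge ω η) := by
  ext ζ
  have hsign : (-1 : k) ^ (n * l) * (-1) ^ (n * (i + l)) = (-1) ^ (n * i) := by
    rw [← pow_add, show n * l + n * (i + l) = n * i + 2 * (n * l) by ring, pow_add,
      pow_mul _ 2, neg_one_sq, one_pow, mul_one]
  simp [smul_smul, hsign, mul_assoc]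

/-- The divergence `vol ∘ d`, transported to `ℐ₁` along the pairing of `Ωⁿ` with `Ω¹`. -/
noncomputable def divergence (hbij : Function.Bijective (vol.pairing n n 1)) : Ω.Divergence where
  toLin := vol.toLin ∘ₗ Ω.d ∘ₗ (Ω.grade n).subtype ∘ₗ (LinearEquiv.ofBijective _ hbij).symm
  leibniz φ a := by
    have hsign : (-1 : k) ^ (n * n) = (-1) ^ n := by
      rcases Nat.even_or_odd n with hn | hn <;> simp [hn.neg_one_pow, pow_mul]
    obtain ⟨ω, rfl⟩ := (LinearEquiv.ofBijective _ hbij).surjective φ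
    have h : rightAct (LinearEquiv.ofBijective _ hbij ω) a =
        LinearEquiv.ofBijective _ hbij (rmul ω a) := (vol.pairing_rmul n ω a).symm
    rw [h]
    simp [leibniz_smul ω.2, vol.map_mul_ι, hsign]

variable (hbij : Function.Bijective (vol.pairing n n 1))

theorem divergence_pairing (ω : Ω.grade n) :
    (vol.divergence hbij).toLin (vol.pairing n n 1 ω) = vol.toLin (Ω.d ω) := by
  have h : (LinearEquiv.ofBijective _ hbij).symm (vol.pairing n n 1 ω) = ω :=
    (LinearEquiv.ofBijective _ hbij).symm_apply_apply ω
  simp [divergence, h]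

theorem divergence_ext_pairing {i l : ℕ} (h : i + l = n) (ω : Ω.grade i) :
    (vol.divergence hbij).ext l (vol.pairing n i (l + 1) ω) =
      vol.pairing n (i + 1) l (Ω.dGrade i ω) := by
  subst h
  ext η
  have hη : (-1 : k) ^ ((i + l) * l) * (-1) ^ i = (-1) ^ l * (-1) ^ ((i + l) * i) := by
    rcases Nat.even_or_odd i with hi | hi <;> rcases Nat.even_or_odd l with hl | hl <;>
      simp [hi.neg_one_pow, hl.neg_one_pow, pow_mul, pow_add]
  have hω : (-1 : k) ^ ((i + l) * l) = (-1) ^ ((i + l) * (i + 1)) := by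
    rcases Nat.even_or_odd i with hi | hi <;> rcases Nat.even_or_odd l with hl | hl <;>
      simp [hi.neg_one_pow, hl.neg_one_pow, pow_mul, pow_add]
  rw [Divergence.ext_apply, formAct_pairing, map_smul, divergence_pairing, coe_wedge,
    leibniz_smul ω.2, map_add, map_smul, smul_add, smul_smul, hη, hω]
  simp only [pairing_apply, coe_dGrade]
  module

theorem isIntegrable_of_bijective_pairing
    (hbij : ∀ i l, i + l = n + 2 → Function.Bijective (vol.pairing (n + 1) i l)) :
    Ω.IsIntegrable (n + 2) := by
  refine ⟨vol.divergence (hbij (n + 1) 1 rfl), vol.twist,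
    fun i l h => LinearEquiv.ofBijective _ (hbij i l h), ?_, ?_, ?_⟩
  · intro φ
    obtain ⟨ω, rfl⟩ := (hbij n 2 rfl).surjective φ
    rw [vol.divergence_ext_pairing _ rfl, divergence_pairing, coe_dGrade, Ω.d_d,
      map_zero]
  · intro i l h a b ω
    exact (vol.pairing_lmul (n + 1) a _).trans (congrArg _ (vol.pairing_rmul (n + 1) ω b))
  · intro i l h ω
    exact (vol.divergence_ext_pairing _ (by omega) ω).symm

theorem bijective_pairing (n : ℕ) {i l : ℕ}
    (hinj : ∀ ω : Ω.grade i, (∀ η : Ω.grade l, vol.toLin (ω * η) = 0) → ω = 0)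
    (hsurj : ∀ φ : Ω.IntegralForm l, ∃ ω : Ω.grade i, ∀ η : Ω.grade l,
      vol.toLin (ω * η) = φ.1 η) :
    Function.Bijective (vol.pairing n i l) := by
  have hsign : (-1 : k) ^ (n * i) ≠ 0 := pow_ne_zero _ (neg_ne_zero.2 one_ne_zero)
  constructor
  · refine (injective_iff_map_eq_zero _).2 fun ω hω => hinj ω fun η => ?_
    have h : (vol.pairing n i l ω).1 η = 0 := by simp [hω]
    exact (smul_eq_zero_iff_right hsign).1 h
  · intro φ
    obtain ⟨ω, hω⟩ := hsurj φ
    refine ⟨((-1 : k) ^ (n * i))⁻¹ • ω, ?_⟩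
    ext η
    rw [map_smul, ← hω η]
    exact inv_smul_smul₀ hsign _

theorem bijective_pairing_zero_right (n : ℕ) {i : ℕ}
    (hvol : Function.Bijective (vol.toLin.domRestrict (Ω.grade i))) :
    Function.Bijective (vol.pairing n i 0) := by
  let one : Ω.grade 0 := ⟨Ω.ι 1, Ω.ι_mem 1⟩
  refine vol.bijective_pairing n (fun ω hω => ?_) fun φ => ?_
  · exact (injective_iff_map_eq_zero _).1 hvol.injective ω (by simpa [one] using hω one)
  · obtain ⟨ω, hω⟩ := hvol.surjective (φ.1 one)
    refine ⟨ω, fun ⟨η, hη⟩ => ?_⟩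
    obtain ⟨a, rfl : Ω.ι a = η⟩ := Ω.range_ι.ge hη
    have hone : rmul one a = ⟨Ω.ι a, hη⟩ := Subtype.ext (by simp [one])
    calc vol.toLin (ω * Ω.ι a) = φ.1 one * a := by rw [vol.map_mul_ι, ← hω]; rfl
      _ = φ.1 ⟨Ω.ι a, hη⟩ := by rw [← hone, φ.2]

theorem bijective_pairing_zero_left (n : ℕ) {l : ℕ}
    (hvol : Function.Bijective (vol.toLin.domRestrict (Ω.grade l))) :
    Function.Bijective (vol.pairing n 0 l) := by
  obtain ⟨η₁, hη₁⟩ := hvol.surjective 1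
  rw [LinearMap.domRestrict_apply] at hη₁
  refine vol.bijective_pairing n (fun ⟨ω, hω⟩ h => ?_) fun φ => ?_
  · obtain ⟨a, rfl : Ω.ι a = ω⟩ := Ω.range_ι.ge hω
    have ha : a = 0 := by simpa [vol.map_ι_mul, hη₁] using h η₁
    exact Subtype.ext (by simp [ha])
  · refine ⟨⟨Ω.ι (vol.twist.symm (φ.1 η₁)), Ω.ι_mem _⟩, fun η => ?_⟩
    have hη : η = rmul η₁ (vol.toLin η) := hvol.injective (by simp [vol.map_mul_ι, hη₁])
    calc vol.toLin (Ω.ι (vol.twist.symm (φ.1 η₁)) * η) = φ.1 η₁ * vol.toLin η := by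
          simp [vol.map_ι_mul]
      _ = φ.1 η := by rw [← φ.2, ← hη]

end TwistedVolume

end DGAlgebraOver

/-! ### The pillow calculus -/

section PerfectPairing

variable {k R : Type*} [CommRing k] [Ring R] [Algebra k R] {M : Submodule k R}

theorem eq_zero_of_forall_mul_eq_zero (h₁ : 1 ∈ M * M) {m : R} (hm : ∀ y ∈ M, m * y = 0) :
    m = 0 := by
  have h : M * M ≤ LinearMap.ker (LinearMap.mulLeft k m) :=
    Submodule.mul_le.2 fun y hy z _ => by simp [← mul_assoc, hm y hy]
  simpa using h h₁

/- If `1 = ∑ sᵢ tᵢ` with `sᵢ, tᵢ ∈ M`, then `m = ∑ f(sᵢ) tᵢ`. -/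
theorem exists_eq_mul_of_map_mul_mul (h₁ : 1 ∈ M * M) (h₃ : M * M * M ≤ M) (f : M →ₗ[k] R)
    (hf : ∀ s t y z : M, (z : R) = s * (t * y) → f z = f s * (t * y)) :
    ∃ m ∈ LinearMap.range f * M, ∀ y : M, f y = m * y := by
  suffices h : ∀ a ∈ M * M, ∃ m ∈ LinearMap.range f * M, ∀ y z : M, (z : R) = a * y →
      f z = m * y by
    obtain ⟨m, hm, hmy⟩ := h 1 h₁
    exact ⟨m, hm, fun y => hmy y y (one_mul _).symm⟩
  intro a ha
  induction ha using Submodule.mul_induction_on' with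
  | mem_mul_mem s hs t ht =>
    refine ⟨f ⟨s, hs⟩ * t, Submodule.mul_mem_mul ⟨_, rfl⟩ ht, fun y z hz => ?_⟩
    rw [mul_assoc]
    exact hf ⟨s, hs⟩ ⟨t, ht⟩ y z (hz.trans (mul_assoc _ _ _))
  | add s hs t ht hms hmt =>
    obtain ⟨m, hm, hmy⟩ := hms
    obtain ⟨n, hn, hny⟩ := hmt
    refine ⟨m + n, Submodule.add_mem _ hm hn, fun y z hz => ?_⟩
    let sy : M := ⟨s * y, h₃ (Submodule.mul_mem_mul hs y.2)⟩
    let ty : M := ⟨t * y, h₃ (Submodule.mul_mem_mul ht y.2)⟩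
    obtain rfl : z = sy + ty := Subtype.ext (hz.trans (add_mul _ _ _))
    rw [map_add, hmy y sy rfl, hny y ty rfl, add_mul]

end PerfectPairing

namespace PillowForm

variable {θ : ℝ}

section Components

variable (a : Pillow θ)

@[simp]
theorem f0_incl : (incl a).f0 = a := rfl

@[simp]
theorem fV_incl : (incl a).fV = 0 := rfl

@[simp]
theorem fW_incl : (incl a).fW = 0 := rfl

@[simp]
theorem f2_incl : (incl a).f2 = 0 := rfl

end Components

/-- The one-form `(p y, q y)`. -/
noncomputable def oneForm (p q : ℂ) : Minus θ →ₗ[ℂ] grade θ 1 :=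
  LinearMap.codRestrict (grade θ 1)
    { toFun := fun y => mk 0 (p • y) (q • y) 0 (by simp)
        (mem_minus.1 ((Minus θ).smul_mem p y.2)) (mem_minus.1 ((Minus θ).smul_mem q y.2)) (by simp)
      map_add' := fun y z => by ext <;> simp
      map_smul' := fun c y => by ext <;> simp [smul_comm c] }
    fun _ => ⟨rfl, rfl⟩

section Components

variable (p q : ℂ) (y : Minus θ)

@[simp]
theorem f0_oneForm : (oneForm p q y : PillowForm θ).f0 = 0 := rfl

@[simp]
theorem fV_oneForm : (oneForm p q y : PillowForm θ).fV = p • y := rfl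

@[simp]
theorem fW_oneForm : (oneForm p q y : PillowForm θ).fW = q • y := rfl

@[simp]
theorem f2_oneForm : (oneForm p q y : PillowForm θ).f2 = 0 := rfl

end Components

theorem eq_oneForm_add_oneForm (x : grade θ 1) :
    x = oneForm 1 0 ⟨x.1.fV, x.1.sigma_fV⟩ + oneForm 0 1 ⟨x.1.fW, x.1.sigma_fW⟩ := by
  obtain ⟨x, h0, h2⟩ := x
  ext <;> simp [h0, h2]

theorem oneForm_mul_right (p q : ℂ) {y z : Minus θ} {a : Pillow θ} (h : (z : Torus θ) = y * a) :
    (oneForm p q z : PillowForm θ) = oneForm p q y * incl a := by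
  ext <;> simp [h]

theorem oneForm_mul_left (p q : ℂ) {y z : Minus θ} {a : Pillow θ} (h : (z : Torus θ) = a * y) :
    (oneForm p q z : PillowForm θ) = incl a * oneForm p q y := by
  ext <;> simp [h]

theorem d_incl_eigenMonomial (x : ℤ × ℤ) :
    d (incl ⟨Torus.eigenMonomial 1 x, Torus.eigenMonomial_one_mem x⟩ : PillowForm θ) =
      Complex.I • (oneForm x.1 x.2
        ⟨Torus.eigenMonomial (-1) x, Torus.eigenMonomial_neg_one_mem x⟩ : grade θ 1) := by
  ext <;> simp [Torus.derV, Torus.derW, Torus.der_eigenMonomial, smul_smul, mul_comm]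

theorem incl_mem_grade_zero (a : Pillow θ) : incl a ∈ grade θ 0 := ⟨rfl, rfl, rfl⟩

theorem oneForm_mem_of_oneForm_eigenMonomial_mem (hθ : Irrational θ)
    {N : Submodule ℂ (PillowForm θ)} (hl : grade θ 0 * N ≤ N) (hr : N * grade θ 0 ≤ N) {p q : ℂ}
    {e : ℤ × ℤ} (he : e ≠ 0)
    (h : (oneForm p q ⟨Torus.eigenMonomial (-1) e, Torus.eigenMonomial_neg_one_mem e⟩).1 ∈ N)
    (y : Minus θ) : (oneForm p q y : PillowForm θ) ∈ N := by
  let S : Submodule ℂ (Torus θ) :=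
    (N.comap ((grade θ 1).subtype ∘ₗ oneForm p q)).map (Minus θ).subtype
  suffices hS : Minus θ ≤ S by
    obtain ⟨z, hz, hzy⟩ := hS y.2
    rwa [Subtype.ext hzy] at hz
  refine Torus.minus_le_of_eigenMonomial_mem hθ (Submodule.mul_le.2 ?_) (Submodule.mul_le.2 ?_) he
    ⟨_, h, rfl⟩
  · rintro a ha _ ⟨z, hz, rfl⟩
    let az : Minus θ := ⟨a * z, Torus.pillow_mul_minus_le (Submodule.mul_mem_mul ha z.2)⟩
    suffices h : (oneForm p q az : PillowForm θ) ∈ N from ⟨az, h, rfl⟩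
    rw [oneForm_mul_left p q (a := ⟨a, ha⟩) rfl]
    exact hl (Submodule.mul_mem_mul (incl_mem_grade_zero _) hz)
  · rintro _ ⟨z, hz, rfl⟩ a ha
    let za : Minus θ := ⟨z * a, Torus.minus_mul_pillow_le (Submodule.mul_mem_mul z.2 ha)⟩
    suffices h : (oneForm p q za : PillowForm θ) ∈ N from ⟨za, h, rfl⟩
    rw [oneForm_mul_right p q (a := ⟨a, ha⟩) rfl]
    exact hr (Submodule.mul_mem_mul hz (incl_mem_grade_zero _))

theorem oneForm_mem_grade_zero_mul_map_d (hθ : Irrational θ) {x : ℤ × ℤ} (hx : x ≠ 0)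
    (y : Minus θ) :
    (oneForm x.1 x.2 y : PillowForm θ) ∈ grade θ 0 * (grade θ 0).map d := by
  have hl : grade θ 0 * (grade θ 0 * (grade θ 0).map d) ≤ grade θ 0 * (grade θ 0).map d := by
    rw [← mul_assoc]
    exact mul_le_mul_left ((pillowCalculus θ).grade_mul_grade_le 0 0) _
  have hr : grade θ 0 * (grade θ 0).map d * grade θ 0 ≤ grade θ 0 * (grade θ 0).map d := by
    rw [mul_assoc]
    exact (mul_le_mul_right (pillowCalculus θ).map_d_mul_grade_zero_le _).trans hl
  refine oneForm_mem_of_oneForm_eigenMonomial_mem hθ hl hr hx ?_ y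
  have h : d (incl ⟨Torus.eigenMonomial 1 x, Torus.eigenMonomial_one_mem x⟩) ∈
      grade θ 0 * (grade θ 0).map d := by
    have h := Submodule.mul_mem_mul (incl_mem_grade_zero (θ := θ) 1)
      (Submodule.mem_map_of_mem (f := d) (incl_mem_grade_zero
        ⟨Torus.eigenMonomial 1 x, Torus.eigenMonomial_one_mem x⟩))
    rwa [map_one, one_mul] at h
  rw [d_incl_eigenMonomial] at h
  exact (Submodule.smul_mem_iff _ Complex.I_ne_zero).1 h

theorem grade_one_le (hθ : Irrational θ) : grade θ 1 ≤ grade θ 0 * (grade θ 0).map d := by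
  intro x hx
  have h : x = _ := congrArg Subtype.val (eq_oneForm_add_oneForm ⟨x, hx⟩)
  rw [h, Submodule.coe_add]
  refine Submodule.add_mem _ ?_ ?_
  · simpa using oneForm_mem_grade_zero_mul_map_d hθ (x := (1, 0)) (by simp) _
  · simpa using oneForm_mem_grade_zero_mul_map_d hθ (x := (0, 1)) (by simp) _

/-- The projection of forms on `Ω² = 𝒪(ℙ_θ)`. -/
noncomputable def topComponent : PillowForm θ →ₗ[ℂ] Pillow θ where
  toFun x := ⟨x.f2, x.sigma_f2⟩
  map_add' _ _ := rfl
  map_smul' _ _ := rfl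

@[simp]
theorem coe_topComponent (x : PillowForm θ) : (topComponent x : Torus θ) = x.f2 := rfl

theorem topComponent_mul_incl (x : PillowForm θ) (a : Pillow θ) :
    topComponent (x * incl a) = topComponent x * a := by
  ext
  simp

theorem topComponent_incl_mul (a : Pillow θ) (x : PillowForm θ) :
    topComponent (incl a * x) = a * topComponent x := by
  ext
  simp

theorem topComponent_bijective_on_grade_two :
    Function.Bijective (topComponent.domRestrict (grade θ 2)) := by
  constructor
  · rintro ⟨x, hx0, hxV, hxW⟩ ⟨y, hy0, hyV, hyW⟩ h
    exact Subtype.ext (PillowForm.ext (hx0.trans hy0.symm) (hxV.trans hyV.symm)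
      (hxW.trans hyW.symm) (congrArg Subtype.val h))
  · exact fun a => ⟨⟨mk 0 0 0 a (by simp) (by simp) (by simp) (mem_pillow.1 a.2), rfl, rfl, rfl⟩,
      rfl⟩

theorem grade_two_le (hθ : Irrational θ) : grade θ 2 ≤ grade θ 1 * grade θ 1 := by
  have h : Minus θ * Minus θ ≤
      (grade θ 1 * grade θ 1).map ((Pillow θ).val.toLinearMap ∘ₗ topComponent) :=
    Submodule.mul_le.2 fun y hy z hz =>
      ⟨_, Submodule.mul_mem_mul (oneForm 1 0 ⟨y, hy⟩).2 (oneForm 0 1 ⟨z, hz⟩).2, by simp⟩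
  intro x hx
  obtain ⟨w, hw, hwx⟩ := h (Torus.pillow_le_minus_mul_minus hθ (topComponent x).2)
  have hw₂ : w ∈ grade θ 2 := (pillowCalculus θ).grade_mul_grade_le 1 1 hw
  have hwx : (⟨w, hw₂⟩ : grade θ 2) = ⟨x, hx⟩ :=
    topComponent_bijective_on_grade_two.injective (Subtype.ext hwx)
  rwa [Subtype.mk.inj hwx] at hw

theorem eq_zero_of_forall_topComponent_mul_eq_zero (hθ : Irrational θ) {x : grade θ 1}
    (hx : ∀ y : grade θ 1, topComponent (x * y : PillowForm θ) = 0) : x = 0 := by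
  have h₁ := Torus.one_mem_minus_mul_minus hθ
  have hV : fV x = 0 := eq_zero_of_forall_mul_eq_zero h₁ fun y hy => by
    simpa using congrArg Subtype.val (hx (oneForm 0 1 ⟨y, hy⟩))
  have hW : fW x = 0 := eq_zero_of_forall_mul_eq_zero h₁ fun y hy => by
    simpa using congrArg Subtype.val (hx (oneForm 1 0 ⟨y, hy⟩))
  exact Subtype.ext (PillowForm.ext x.2.1 hV hW x.2.2)

section RightLinear

variable {φ : grade θ 1 →ₗ[ℂ] Pillow θ}

theorem exists_apply_oneForm_eq_mul (hθ : Irrational θ)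
    (hφ : ∀ (y z : grade θ 1) (a : Pillow θ), (z : PillowForm θ) = y * incl a → φ z = φ y * a)
    (p q : ℂ) : ∃ m : Minus θ, ∀ y, (φ (oneForm p q y) : Torus θ) = m * y := by
  have h₃ : Minus θ * Minus θ * Minus θ ≤ Minus θ :=
    (mul_le_mul_left Torus.minus_mul_minus_le _).trans Torus.pillow_mul_minus_le
  obtain ⟨m, hm, h⟩ := exists_eq_mul_of_map_mul_mul (Torus.one_mem_minus_mul_minus hθ) h₃
    ((Pillow θ).val.toLinearMap ∘ₗ φ ∘ₗ oneForm p q) fun s t y z hz => by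
      let ty : Pillow θ := ⟨t * y, Torus.minus_mul_minus_le (Submodule.mul_mem_mul t.2 y.2)⟩
      have h := hφ _ _ ty (oneForm_mul_right p q (a := ty) hz)
      exact congrArg Subtype.val h
  have hrange : LinearMap.range ((Pillow θ).val.toLinearMap ∘ₗ φ ∘ₗ oneForm p q) ≤
      (Pillow θ).toSubmodule := by
    rintro _ ⟨y, rfl⟩
    exact (φ (oneForm p q y)).2
  exact ⟨⟨m, Torus.pillow_mul_minus_le (mul_le_mul_left hrange _ hm)⟩, h⟩

theorem exists_topComponent_mul_eq (hθ : Irrational θ)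
    (hφ : ∀ (y z : grade θ 1) (a : Pillow θ), (z : PillowForm θ) = y * incl a → φ z = φ y * a) :
    ∃ x : grade θ 1, ∀ y : grade θ 1, topComponent (x * y : PillowForm θ) = φ y := by
  obtain ⟨v, hv⟩ := exists_apply_oneForm_eq_mul hθ hφ 1 0
  obtain ⟨w, hw⟩ := exists_apply_oneForm_eq_mul hθ hφ 0 1
  refine ⟨oneForm 1 0 w - oneForm 0 1 v, fun y => ?_⟩
  rw [eq_oneForm_add_oneForm y, map_add]
  ext
  simp [hv, hw, sub_eq_add_neg, add_comm]

end RightLinear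

end PillowForm

section PillowCalculus

open PillowForm

variable {θ : ℝ}

theorem pillowCalculus_isCalculus (hθ : Irrational θ) : (pillowCalculus θ).IsCalculus := by
  refine (pillowCalculus θ).isCalculus_of_grade_succ_le (grade_one_le hθ) ?_
  rintro (_ | _ | n)
  · exact le_mul_of_one_le_left' (pillowCalculus θ).one_le_grade_zero
  · exact grade_two_le hθ
  · exact bot_le

theorem pillowCalculus_hasDimension (θ : ℝ) : (pillowCalculus θ).HasDimension 2 := by
  constructor
  · intro h
    obtain ⟨⟨x, hx⟩, hx₁⟩ := topComponent_bijective_on_grade_two.surjective (1 : Pillow θ)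
    obtain rfl : x = 0 := (Submodule.mem_bot ℂ).1 (h.le hx)
    exact zero_ne_one (hx₁.symm.trans (map_zero _)).symm
  · intro m hm
    obtain ⟨n, rfl⟩ := Nat.exists_eq_add_of_le' hm
    rfl

theorem pillowCalculus_isConnected (θ : ℝ) : (pillowCalculus θ).IsConnected := by
  intro a
  constructor
  · intro h
    obtain ⟨c, hc⟩ := Torus.exists_eq_algebraMap_of_derV_eq_zero_of_derW_eq_zero
      (congrArg fV h : Torus.derV (a : Torus θ) = 0) (congrArg fW h)
    exact ⟨c, Subtype.ext hc⟩
  · rintro ⟨c, rfl⟩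
    suffices h : d (incl (algebraMap ℂ (Pillow θ) c)) = 0 from h
    ext
    · simp
    · exact Torus.der_algebraMap _ _ _
    · exact Torus.der_algebraMap _ _ _
    · rw [f2_d, fV_incl, fW_incl, map_zero, map_zero, sub_zero, f2_zero]

/-- The projection on `Ω²`, which is bilinear over `𝒪(ℙ_θ)`. -/
noncomputable def pillowVolume (θ : ℝ) : (pillowCalculus θ).TwistedVolume where
  toLin := topComponent
  twist := AlgEquiv.refl
  map_mul_ι := topComponent_mul_incl
  map_ι_mul := topComponent_incl_mul

theorem bijective_pillowVolume_pairing_one_one (hθ : Irrational θ) :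
    Function.Bijective ((pillowVolume θ).pairing 1 1 1) := by
  refine (pillowVolume θ).bijective_pairing 1
    (fun _ => eq_zero_of_forall_topComponent_mul_eq_zero hθ) fun φ => ?_
  refine exists_topComponent_mul_eq hθ (φ := φ.1) fun y z a hz => ?_
  exact (congrArg φ.1 (Subtype.ext hz)).trans (φ.2 y a)

theorem pillowCalculus_isIntegrable (hθ : Irrational θ) : (pillowCalculus θ).IsIntegrable 2 := by
  refine (pillowVolume θ).isIntegrable_of_bijective_pairing fun i l h => ?_
  obtain ⟨rfl, rfl⟩ | ⟨rfl, rfl⟩ | ⟨rfl, rfl⟩ :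
    i = 0 ∧ l = 2 ∨ i = 1 ∧ l = 1 ∨ i = 2 ∧ l = 0 := by omega
  · exact (pillowVolume θ).bijective_pairing_zero_left 1 topComponent_bijective_on_grade_two
  · exact bijective_pillowVolume_pairing_one_one hθ
  · exact (pillowVolume θ).bijective_pairing_zero_right 1 topComponent_bijective_on_grade_two

end PillowCalculus

theorem theorem3p2 (θ : ℝ) (hθ : Irrational θ) :
    (pillowCalculus θ).IsCalculus ∧
    (pillowCalculus θ).HasDimension 2 ∧
    (pillowCalculus θ).IsConnected ∧
    (pillowCalculus θ).IsIntegrable 2 ∧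
    IsAffineOfGKDim ℂ (Pillow θ) 2 ∧
    IsDifferentiallySmooth ℂ (Pillow θ) :=
  ⟨pillowCalculus_isCalculus hθ, pillowCalculus_hasDimension θ, pillowCalculus_isConnected θ,
    pillowCalculus_isIntegrable hθ, pillow_isAffineOfGKDim hθ,
    2, pillow_isAffineOfGKDim hθ, pillowCalculus θ, pillowCalculus_isCalculus hθ,
    pillowCalculus_hasDimension θ, pillowCalculus_isConnected θ, pillowCalculus_isIntegrable hθ⟩
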